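/- Let $n,m,m_1,m_2,n_1,n_2$ be nonnegative integers and let $f:\mathbb R^n\times\mathbb R^m\to\mathbb R$, $h:\mathbb R^n\times\mathbb R^m\to\mathbb R^{m_1}$, $g:\mathbb R^n\times\mathbb R^m\to\mathbb R^{m_2}$, $H:\mathbb R^n\to\mathbb R^{n_1}$, $G:\mathbb R^n\to\mathbb R^{n_2}$. Consider $$\min_{x\in\Phi}\ \max_{y\in Y(x)} f(x,y),\qquad \Phi=\{x: H(x)=0,\ G(x)\le 0\},\quad Y(x)=\{y: h(x,y)=0,\ g(x,y)\le 0\}.$$ Write $\mathbf B_\delta(\cdot)$ for closed Euclidean balls. A point $(x^*,y^*)$ with $x^*\in\Phi$, $y^*\in Y(x^*)$ is a local minimax point if there are $\delta_0>0$ and $\eta:(0,\delta_0]\to[0,\infty)$ with $\eta(\delta)\to0$ as $\delta\downarrow0$ such that for all $\delta\in(0,\delta_0]$, $x\in \mathbf B_\delta(x^*)\cap\Phi$, $y\in Y(x^*)\cap \mathbf B_\delta(y^*)$, $$f(x^*,y)\le f(x^*,y^*)\le \max\{f(x,z): z\in Y(x)\cap \mathbf B_{\eta(\delta)}(y^*)\}$$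 (the maximum being attained). Let $\mathcal L(x,z,\mu,\lambda)=f(x,z)+\mu^Th(x,z)-\lambda^Tg(x,z)$, $\alpha=\{i: g_i(x^*,y^*)=0\}$, $I(x^*)=\{i:G_i(x^*)=0\}$, and $$\mathcal C_{x^*}(y^*)=\{d_y: \mathcal J_yh(x^*,y^*)d_y=0;\ \nabla_yg_i(x^*,y^*)^Td_y\le0,\ i\in\alpha;\ \nabla_yf(x^*,y^*)^Td_y\ge0\}.$$ **Theorem (necessary optimality conditions).** Let $f,h,g$ be twice continuously differentiable around $(x^*,y^*)$ and $H,G$ twice continuously differentiable around $x^*$. Let $(x^*,y^*)$ be a local minimax point, and assume the linear independence constraint qualification (LICQ) holds at $y^*$ for $Y(x^*)$: the vectors $\nabla_yh_j(x^*,y^*)$ $(1\le j\le m_1)$ and $\nabla_yg_i(x^*,y^*)$ $(i\in\alpha)$ are linearly independent. Then there is a unique $(\mu^*,\lambda^*)\in\mathbb R^{m_1}\times\mathbb R^{m_2}$ with $$\nabla_y\mathcal L(x^*,y^*,\mu^*,\lambda^*)=0,\quad h(x^*,y^*)=0,\quad 0\le\lambda^*\perp g(x^*,y^*)\le0,\tag{1}$$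 and for every $d_y\in\mathcal C_{x^*}(y^*)$, $$\langle\nabla^2_{yy}\mathcal L(x^*,y^*,\mu^*,\lambda^*)d_y,d_y\rangle\le0.$$ Assume further that (i) the Jacobian uniqueness conditions hold for the lower-level problem $\max_{z\in Y(x^*)} f(x^*,z)$ at $(y^*,\mu^*,\lambda^*)$: (1), LICQ, strict complementarity $\lambda_i^*-g_i(x^*,y^*)>0$ for all $i$, and $\langle\nabla^2_{yy}\mathcal L(x^*,y^*,\mu^*,\lambda^*)d_y,d_y\rangle<0$ for all $d_y\in\mathcal C_{x^*}(y^*)\setminus\{0\}$; (ii) the Mangasarian--Fromovitz constraint qualification holds for $\Phi$ at $x^*$: the vectors $\nabla H_j(x^*)$, $1\le j\le n_1$, are linearly independent, and there is $\bar d$ with $\nabla H_j(x^*)^T\bar d=0$ for all $j$ and $\nabla G_i(x^*)^T\bar d<0$ for $i\in I(x^*)$. Then the set $\Lambda(x^*)$ of all $(u,v)\in\mathbb R^{n_1}\times\mathbb R^{n_2}$ satisfying $$\nabla_x\mathcal L(x^*,y^*,\mu^*,\lambda^*)+\mathcal JH(x^*)^Tu+\mathcal JG(x^*)^Tv=0,\quad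 H(x^*)=0,\quad 0\le v\perp G(x^*)\le0$$ is nonempty, compact and convex. Moreover, with $$K_\alpha=\begin{bmatrix}\nabla^2_{yy}\mathcal L&\mathcal J_yh^T&-\mathcal J_yg_\alpha^T\\ \mathcal J_yh&0&0\\-\mathcal J_yg_\alpha&0&0\end{bmatrix},\qquad N_\alpha=\begin{bmatrix}\nabla^2_{xy}\mathcal L\\ \mathcal J_xh\\-\mathcal J_xg_\alpha\end{bmatrix}$$ evaluated at $(x^*,y^*,\mu^*,\lambda^*)$, where $\nabla^2_{xy}\mathcal L$ is the $m\times n$ Jacobian in $x$ of $\nabla_y\mathcal L$, the matrix $K_\alpha$ is nonsingular, and for every $$d_x\in\mathcal C(x^*)=\{d_x:\mathcal JH(x^*)d_x=0;\ \nabla G_i(x^*)^Td_x\le0,\ i\in I(x^*);\ \nabla_x\mathcal L(x^*,y^*,\mu^*,\lambda^*)^Td_x\le0\}$$ one has $$\max_{(u,v)\in\Lambda(x^*)}\Big\langle\Big[\sum_{j=1}^{n_1}u_j\nabla^2H_j(x^*)+\sum_{i=1}^{n_2}v_i\nabla^2G_i(x^*)\Big]d_x,d_x\Big\rangle+\Big\langle\big[\nabla^2_{xx}\mathcal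 L(x^*,y^*,\mu^*,\lambda^*)-N_\alpha^TK_\alpha^{-1}N_\alpha\big]d_x,d_x\Big\rangle\ge0,$$ the maximum being attained. -/

import Mathlib

open Filter Topology Matrix

noncomputable section

/-- Real Euclidean space of dimension `k`. -/
abbrev Eu (k : ℕ) : Type := EuclideanSpace ℝ (Fin k)

/-- Jacobian matrix of `F` at `x`: the `(i, j)` entry is `∂F_i / ∂x_j`. -/
def jac {a b : ℕ} (F : Eu a → Eu b) (x : Eu a) : Matrix (Fin b) (Fin a) ℝ :=
  Matrix.of fun i j => fderiv ℝ F x (EuclideanSpace.single j 1) i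

/-- Hessian matrix of a scalar function: the Jacobian of its gradient. -/
def hess {a : ℕ} (φ : Eu a → ℝ) (x : Eu a) : Matrix (Fin a) (Fin a) ℝ :=
  jac (fun x' => gradient φ x') x

/-- The quadratic form `⟨A d, d⟩`. -/
def quad {a : ℕ} (A : Matrix (Fin a) (Fin a) ℝ) (d : Eu a) : ℝ :=
  inner ℝ (Matrix.toEuclideanLin A d) d

/-- The data of the problem `min_{x ∈ Φ} max_{y ∈ Y(x)} f(x, y)`, with
`Φ = {x | H x = 0, G x ≤ 0}` and `Y(x) = {y | h(x, y) = 0, g(x, y) ≤ 0}`. -/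
structure MinimaxProblem (n m m₁ m₂ n₁ n₂ : ℕ) where
  f : Eu n → Eu m → ℝ
  h : Eu n → Eu m → Eu m₁
  g : Eu n → Eu m → Eu m₂
  H : Eu n → Eu n₁
  G : Eu n → Eu n₂

namespace MinimaxProblem

variable {n m m₁ m₂ n₁ n₂ : ℕ} (P : MinimaxProblem n m m₁ m₂ n₁ n₂)

/-- The upper-level feasible set. -/
def Phi : Set (Eu n) := {x | P.H x = 0 ∧ ∀ i, P.G x i ≤ 0}

/-- The lower-level feasible set. -/
def Y (x : Eu n) : Set (Eu m) := {y | P.h x y = 0 ∧ ∀ i, P.g x y i ≤ 0}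

/-- Local minimax points. The maximum over `z` is required to be attained. -/
def IsLocalMinimax (xs : Eu n) (ys : Eu m) : Prop :=
  xs ∈ P.Phi ∧ ys ∈ P.Y xs ∧
    ∃ (δ₀ : ℝ) (η : ℝ → ℝ), 0 < δ₀ ∧ (∀ δ ∈ Set.Ioc 0 δ₀, 0 ≤ η δ) ∧
      Tendsto η (𝓝[>] 0) (𝓝 0) ∧
      ∀ δ ∈ Set.Ioc 0 δ₀,
        ∀ x ∈ Metric.closedBall xs δ ∩ P.Phi, ∀ y ∈ P.Y xs ∩ Metric.closedBall ys δ,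
          P.f xs y ≤ P.f xs ys ∧
          ∃ M, IsGreatest (P.f x '' (P.Y x ∩ Metric.closedBall ys (η δ))) M ∧
            P.f xs ys ≤ M

/-- The lower-level Lagrangian `f + μᵀ h - lamᵀ g`. -/
def lagr (x : Eu n) (z : Eu m) (μ : Eu m₁) (lam : Eu m₂) : ℝ :=
  P.f x z + ∑ j, μ j * P.h x z j - ∑ i, lam i * P.g x z i

/-- `∇_x L`. -/
def gradXL (x : Eu n) (y : Eu m) (μ : Eu m₁) (lam : Eu m₂) : Eu n :=
  gradient (fun x' => P.lagr x' y μ lam) x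

/-- `∇_y L`. -/
def gradYL (x : Eu n) (y : Eu m) (μ : Eu m₁) (lam : Eu m₂) : Eu m :=
  gradient (fun y' => P.lagr x y' μ lam) y

/-- `∇²_{xx} L`. -/
def hessXXL (x : Eu n) (y : Eu m) (μ : Eu m₁) (lam : Eu m₂) : Matrix (Fin n) (Fin n) ℝ :=
  hess (fun x' => P.lagr x' y μ lam) x

/-- `∇²_{yy} L`. -/
def hessYYL (x : Eu n) (y : Eu m) (μ : Eu m₁) (lam : Eu m₂) : Matrix (Fin m) (Fin m) ℝ :=
  hess (fun y' => P.lagr x y' μ lam) y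

/-- The mixed second derivative `∇²_{xy} L`, as the `m × n` Jacobian in `x` of `∇_y L`. -/
def hessXYL (x : Eu n) (y : Eu m) (μ : Eu m₁) (lam : Eu m₂) : Matrix (Fin m) (Fin n) ℝ :=
  jac (fun x' => P.gradYL x' y μ lam) x

/-- `∇_y f`. -/
def gradYf (x : Eu n) (y : Eu m) : Eu m := gradient (fun y' => P.f x y') y

/-- `∇_y h_j`. -/
def gradYh (x : Eu n) (y : Eu m) (j : Fin m₁) : Eu m := gradient (fun y' => P.h x y' j) y

/-- `∇_y g_i`. -/
def gradYg (x : Eu n) (y : Eu m) (i : Fin m₂) : Eu m := gradient (fun y' => P.g x y' i) y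

/-- `∇ H_j`. -/
def gradH (x : Eu n) (j : Fin n₁) : Eu n := gradient (fun x' => P.H x' j) x

/-- `∇ G_i`. -/
def gradG (x : Eu n) (i : Fin n₂) : Eu n := gradient (fun x' => P.G x' i) x

/-- The active lower-level inequality constraints. -/
abbrev ActiveLower (x : Eu n) (y : Eu m) : Type := {i : Fin m₂ // P.g x y i = 0}

/-- KKT conditions of the lower-level problem `max_z {f(x, z) : z ∈ Y(x)}`. -/
def IsLowerKKT (x : Eu n) (y : Eu m) (μ : Eu m₁) (lam : Eu m₂) : Prop :=
  P.gradYL x y μ lam = 0 ∧ P.h x y = 0 ∧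
    (∀ i, 0 ≤ lam i) ∧ (∀ i, P.g x y i ≤ 0) ∧ ∑ i, lam i * P.g x y i = 0

/-- Linear independence constraint qualification at `y` for `Y(x)`. -/
def LowerLICQ (x : Eu n) (y : Eu m) : Prop :=
  LinearIndependent ℝ
    (Sum.elim (P.gradYh x y) fun i : P.ActiveLower x y => P.gradYg x y i.1)

/-- Critical cone of the lower-level (maximization) problem. -/
def lowerCriticalCone (x : Eu n) (y : Eu m) : Set (Eu m) :=
  {d | (∀ j, inner ℝ (P.gradYh x y j) d = 0) ∧
    (∀ i, P.g x y i = 0 → inner ℝ (P.gradYg x y i) d ≤ 0) ∧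
    0 ≤ inner ℝ (P.gradYf x y) d}

/-- Jacobian uniqueness conditions of the lower-level problem. -/
structure LowerJacobianUniqueness (x : Eu n) (y : Eu m) (μ : Eu m₁) (lam : Eu m₂) : Prop where
  kkt : P.IsLowerKKT x y μ lam
  licq : P.LowerLICQ x y
  strict_compl : ∀ i, 0 < lam i - P.g x y i
  second_order : ∀ d ∈ P.lowerCriticalCone x y, d ≠ 0 → quad (P.hessYYL x y μ lam) d < 0

/-- Mangasarian-Fromovitz constraint qualification for `Φ` at `x`. -/
def UpperMFCQ (x : Eu n) : Prop :=
  LinearIndependent ℝ (P.gradH x) ∧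
    ∃ d : Eu n, (∀ j, inner ℝ (P.gradH x j) d = 0) ∧
      ∀ i, P.G x i = 0 → inner ℝ (P.gradG x i) d < 0

/-- The set `Λ(x)` of upper-level multipliers `(u, v)`. -/
def upperMultipliers (x : Eu n) (y : Eu m) (μ : Eu m₁) (lam : Eu m₂) : Set (Eu n₁ × Eu n₂) :=
  {w | P.gradXL x y μ lam + ∑ j, w.1 j • P.gradH x j + ∑ i, w.2 i • P.gradG x i = 0 ∧
    P.H x = 0 ∧
    (∀ i, 0 ≤ w.2 i) ∧ (∀ i, P.G x i ≤ 0) ∧ ∑ i, w.2 i * P.G x i = 0}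

/-- The upper-level critical cone `C(x)`. -/
def upperCriticalCone (x : Eu n) (y : Eu m) (μ : Eu m₁) (lam : Eu m₂) : Set (Eu n) :=
  {d | (∀ j, inner ℝ (P.gradH x j) d = 0) ∧
    (∀ i, P.G x i = 0 → inner ℝ (P.gradG x i) d ≤ 0) ∧
    inner ℝ (P.gradXL x y μ lam) d ≤ 0}

/-- `J_y h`. -/
def jacYh (x : Eu n) (y : Eu m) : Matrix (Fin m₁) (Fin m) ℝ := jac (fun y' => P.h x y') y

/-- `J_x h`. -/
def jacXh (x : Eu n) (y : Eu m) : Matrix (Fin m₁) (Fin n) ℝ := jac (fun x' => P.h x' y) x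

/-- `J_y g_α`: the rows of `J_y g` with active index. -/
def jacYgActive (x : Eu n) (y : Eu m) : Matrix (P.ActiveLower x y) (Fin m) ℝ :=
  (jac (fun y' => P.g x y') y).submatrix Subtype.val id

/-- `J_x g_α`: the rows of `J_x g` with active index. -/
def jacXgActive (x : Eu n) (y : Eu m) : Matrix (P.ActiveLower x y) (Fin n) ℝ :=
  (jac (fun x' => P.g x' y) x).submatrix Subtype.val id

/-- The matrix `K_α`, the Jacobian in `(y, μ, lam_α)` of the system `(∇_y L, h, -g_α)`. -/
def Kmat (x : Eu n) (y : Eu m) (μ : Eu m₁) (lam : Eu m₂) :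
    Matrix (Fin m ⊕ (Fin m₁ ⊕ P.ActiveLower x y)) (Fin m ⊕ (Fin m₁ ⊕ P.ActiveLower x y)) ℝ :=
  Matrix.fromBlocks (P.hessYYL x y μ lam)
    (Matrix.fromCols (P.jacYh x y)ᵀ (-(P.jacYgActive x y)ᵀ))
    (Matrix.fromRows (P.jacYh x y) (-(P.jacYgActive x y)))
    0

/-- The matrix `N_α`, the Jacobian in `x` of the system `(∇_y L, h, -g_α)`. -/
def Nmat (x : Eu n) (y : Eu m) (μ : Eu m₁) (lam : Eu m₂) :
    Matrix (Fin m ⊕ (Fin m₁ ⊕ P.ActiveLower x y)) (Fin n) ℝ :=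
  Matrix.fromRows (P.hessXYL x y μ lam)
    (Matrix.fromRows (P.jacXh x y) (-(P.jacXgActive x y)))

/-- The simplified Hessian `∇²_{xx} L - N_αᵀ K_α⁻¹ N_α`. -/
def reducedHess (x : Eu n) (y : Eu m) (μ : Eu m₁) (lam : Eu m₂) : Matrix (Fin n) (Fin n) ℝ :=
  P.hessXXL x y μ lam - (P.Nmat x y μ lam)ᵀ * (P.Kmat x y μ lam)⁻¹ * P.Nmat x y μ lam

/-- `∑ u_j ∇² H_j + ∑ v_i ∇² G_i`. -/
def constraintHess (x : Eu n) (u : Eu n₁) (v : Eu n₂) : Matrix (Fin n) (Fin n) ℝ :=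
  ∑ j, u j • hess (fun x' => P.H x' j) x + ∑ i, v i • hess (fun x' => P.G x' i) x

end MinimaxProblem

end

/-! The lower-level statement is the second-order necessary condition for maximising `f(x*, ·)`:
multipliers are first found separately for each critical direction, and LICQ makes the multiplier
pair unique, so a single pair serves all directions.

The upper-level statement is proved without differentiating an implicit solution map. Let `p(t) = x*
+ t d + t² w + o(t²)` be an arc in `Φ`. The minimax property supplies feasible responses `q(t) → y*`
with `f(p, q) ≥ f(x*, y*)`. By feasibility and complementarity the gain of the Lagrangian is the
gain of `f` plus the slacks `-λ_i g_i`, so it is nonnegative and, by strict complementarity,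
controls every active constraint. Scale displacements by `ρ = t + ‖q - y*‖` and pass to a limit `(τ
d, e)`. Second-order Taylor expansion gives a nonnegative quadratic expression there, and the active
constraints, being `O(ρ²)`, have zero linear part. The lower-level second-order condition excludes
`τ = 0`; after rescaling, `e` solves the linearised constraints with `d` and `0 ≤ ∇_xL·w + ½ D²L(d,
e)²` (`exists_direction_of_arc_response`). The maximum of `D²L(d, e)²` over such `e` is the Schur
complement form of `reducedHess` (`quadratic_le_schur`), whence `0 ≤ ∇_xL·w + ½ ⟨reducedHess d, d⟩`.

Under MFCQ every `w` satisfying the equality equations and strict inequalities of second-order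
tangency is realised by an arc (`exists_arc_of_second_order_tangent`). The inequality is therefore a
linear program in `w`, and duality (`exists_multiplier_of_forall_nonneg`) turns it into upper
multipliers satisfying the second-order estimate. The direction `d = 0` gives nonemptiness; MFCQ
gives compactness, hence attainment. -/

noncomputable section

/-! ### Second-order Taylor expansions along scaled displacements and arcs -/

section Taylor

variable {E : Type*} [NormedAddCommGroup E] [NormedSpace ℝ E]

/-- Mean value inequality for the remainder: its derivative at `s` is `Dφ(x+s) - Dφ(x) - D²φ(x)s`,
at most `ε‖v‖` on the ball of radius `‖v‖`. Symmetry of `D²φ(x)` is what makes `½ D²φ(x)(s, s)` have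
derivative `D²φ(x)s`. -/
theorem taylor_two_isLittleO {φ : E → ℝ} {x : E} (hφ : ContDiffAt ℝ 2 φ x) :
    (fun v => φ (x + v) - φ x - fderiv ℝ φ x v - (1 / 2 : ℝ) * fderiv ℝ (fderiv ℝ φ) x v v)
      =o[𝓝 0] fun v => ‖v‖ ^ 2 := by
  have hsymm : IsSymmSndFDerivAt ℝ φ x := hφ.isSymmSndFDerivAt (by simp)
  have hd : ∀ᶠ y in 𝓝 x, DifferentiableAt ℝ φ y := by
    filter_upwards [hφ.eventually (by simp)] with y hy using hy.differentiableAt (by simp)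
  have h2 : HasFDerivAt (fderiv ℝ φ) (fderiv ℝ (fderiv ℝ φ) x) x :=
    ((hφ.fderiv_right (m := 1) (by norm_num)).differentiableAt (by simp)).hasFDerivAt
  rw [Asymptotics.isLittleO_iff]
  intro ε hε
  have h3 := (Asymptotics.isLittleO_iff.1 h2.isLittleO) hε
  obtain ⟨δ, hδ, hball⟩ := Metric.eventually_nhds_iff_ball.1 (hd.and h3)
  filter_upwards [Metric.ball_mem_nhds (0 : E) hδ] with v hv
  have hv' : ‖v‖ < δ := by simpa using hv
  set D := fderiv ℝ (fderiv ℝ φ) x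
  let ψ : E → ℝ := fun s => φ (x + s) - φ x - fderiv ℝ φ x s - (1 / 2 : ℝ) * D s s
  have hmem : ∀ s ∈ Metric.closedBall (0 : E) ‖v‖, x + s ∈ Metric.ball x δ := by
    intro s hs
    have : ‖s‖ ≤ ‖v‖ := by simpa using hs
    simpa using this.trans_lt hv'
  have hder : ∀ s ∈ Metric.closedBall (0 : E) ‖v‖,
      HasFDerivWithinAt ψ (fderiv ℝ φ (x + s) - fderiv ℝ φ x - D s)
        (Metric.closedBall (0 : E) ‖v‖) s := by
    intro s hs
    have e1 : HasFDerivAt (fun s => φ (x + s)) (fderiv ℝ φ (x + s)) s := by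
      have := (hball _ (hmem s hs)).1.hasFDerivAt
      simpa [Function.comp_def] using this.comp s ((hasFDerivAt_id s).const_add x)
    have e2 : HasFDerivAt (fun s => D s s) ((D.precompR E s) (ContinuousLinearMap.id ℝ E) +
        (D.precompL E (ContinuousLinearMap.id ℝ E)) s) s :=
      D.hasFDerivAt_of_bilinear (hasFDerivAt_id s) (hasFDerivAt_id s)
    have e3 := ((e1.sub_const (φ x)).sub (fderiv ℝ φ x).hasFDerivAt).sub (e2.const_mul (1 / 2 : ℝ))
    refine (e3.congr_fderiv ?_).hasFDerivWithinAt
    ext k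
    have hk : D k s = D s k := hsymm.eq k s
    simp [ContinuousLinearMap.precompR, ContinuousLinearMap.precompL] 
    rw [hk]; ring
  have hbound : ∀ s ∈ Metric.closedBall (0 : E) ‖v‖,
      ‖fderiv ℝ φ (x + s) - fderiv ℝ φ x - D s‖ ≤ ε * ‖v‖ := by
    intro s hs
    have := (hball _ (hmem s hs)).2
    rw [add_sub_cancel_left] at this
    refine this.trans ?_
    have : ‖s‖ ≤ ‖v‖ := by simpa using hs
    gcongr
  have := (convex_closedBall (0 : E) ‖v‖).norm_image_sub_le_of_norm_hasFDerivWithin_le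
    hder hbound (x := 0) (y := v) (by simp) (by simp)
  simp only [ψ] at this
  simpa [sq, mul_assoc] using this

/-- The scale `ρ` and the filter are left free because responses in the lower variable need not move
at speed `t`; they are later normalised by `t` plus their own displacement, along an ultrafilter. -/
theorem tendsto_scaled_taylor_one {α : Type*} {l : Filter α} {φ : E → ℝ} {x : E}
    (hφ : DifferentiableAt ℝ φ x) {v : α → E} {ρ : α → ℝ} {u : E} (hρ : ∀ᶠ t in l, 0 < ρ t)
    (hρ0 : Tendsto ρ l (𝓝 0)) (hv : Tendsto (fun t => (ρ t)⁻¹ • v t) l (𝓝 u)) :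
    Tendsto (fun t => (ρ t)⁻¹ * (φ (x + v t) - φ x)) l (𝓝 (fderiv ℝ φ x u)) := by
  have hv0 : Tendsto v l (𝓝 0) := by
    have := hρ0.smul hv
    rw [zero_smul] at this
    refine this.congr' ?_
    filter_upwards [hρ] with t ht
    rw [smul_inv_smul₀ ht.ne']
  have hvO : v =O[l] ρ := by
    have := (Asymptotics.isBigO_refl ρ l).smul (hv.isBigO_one ℝ)
    simp only [smul_eq_mul, mul_one] at this
    refine this.congr' ?_ EventuallyEq.rfl
    filter_upwards [hρ] with t ht
    rw [smul_inv_smul₀ ht.ne']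
  have h1 : (fun t => φ (x + v t) - φ x - fderiv ℝ φ x (v t)) =o[l] ρ := by
    have := (hasFDerivAt_iff_isLittleO_nhds_zero.1 hφ.hasFDerivAt).comp_tendsto hv0
    exact this.trans_isBigO hvO
  have h2 := h1.tendsto_div_nhds_zero.add (((fderiv ℝ φ x).continuous.tendsto u).comp hv)
  rw [zero_add] at h2
  refine h2.congr' ?_
  filter_upwards [hρ] with t ht
  simp only [Function.comp, map_smul, smul_eq_mul]
  field_simp
  ring

theorem tendsto_scaled_taylor_two {α : Type*} {l : Filter α} {φ : E → ℝ} {x : E}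
    (hφ : ContDiffAt ℝ 2 φ x) {v : α → E} {ρ : α → ℝ} {u : E} (hρ : ∀ᶠ t in l, 0 < ρ t)
    (hρ0 : Tendsto ρ l (𝓝 0)) (hv : Tendsto (fun t => (ρ t)⁻¹ • v t) l (𝓝 u)) :
    Tendsto (fun t => (ρ t ^ 2)⁻¹ * (φ (x + v t) - φ x - fderiv ℝ φ x (v t))) l
      (𝓝 ((1 / 2 : ℝ) * fderiv ℝ (fderiv ℝ φ) x u u)) := by
  have hv0 : Tendsto v l (𝓝 0) := by
    have := hρ0.smul hv
    rw [zero_smul] at this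
    refine this.congr' ?_
    filter_upwards [hρ] with t ht
    rw [smul_inv_smul₀ ht.ne']
  have hvO : v =O[l] ρ := by
    have := (Asymptotics.isBigO_refl ρ l).smul (hv.isBigO_one ℝ)
    simp only [smul_eq_mul, mul_one] at this
    refine this.congr' ?_ EventuallyEq.rfl
    filter_upwards [hρ] with t ht
    rw [smul_inv_smul₀ ht.ne']
  have h1 := ((taylor_two_isLittleO hφ).comp_tendsto hv0).trans_isBigO (hvO.norm_left.pow 2)
  have hq : Continuous fun s : E => (1 / 2 : ℝ) * fderiv ℝ (fderiv ℝ φ) x s s := by fun_prop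
  have h2 := h1.tendsto_div_nhds_zero.add ((hq.tendsto u).comp hv)
  rw [zero_add] at h2
  refine h2.congr' ?_
  filter_upwards [hρ] with t ht
  simp only [Function.comp, map_smul, smul_eq_mul, _root_.smul_apply]
  field_simp
  ring

theorem tendsto_arc_one {x d w : E} {p : ℝ → E}
    (hp : Tendsto (fun t : ℝ => (t ^ 2)⁻¹ • (p t - x - t • d)) (𝓝[>] 0) (𝓝 w)) :
    Tendsto (fun t : ℝ => t⁻¹ • (p t - x)) (𝓝[>] 0) (𝓝 d) := by
  have h0 : Tendsto (fun t : ℝ => t) (𝓝[>] 0) (𝓝 0) := nhdsWithin_le_nhds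
  have := (h0.smul hp).add_const d
  rw [zero_smul, zero_add] at this
  refine this.congr' ?_
  filter_upwards [self_mem_nhdsWithin] with t ht
  have ht : t ≠ 0 := ne_of_gt ht
  rw [smul_smul, smul_sub, smul_smul]
  have e1 : t * (t ^ 2)⁻¹ = t⁻¹ := by field_simp
  rw [e1, inv_mul_cancel₀ ht, one_smul, sub_add_cancel]

/-- Second-order expansion along the arc `x + t d + t² w + o(t²)`. -/
theorem tendsto_arc_taylor {φ : E → ℝ} {x d w : E} (hφ : ContDiffAt ℝ 2 φ x)
    (hd : fderiv ℝ φ x d = 0) {p : ℝ → E}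
    (hp : Tendsto (fun t : ℝ => (t ^ 2)⁻¹ • (p t - x - t • d)) (𝓝[>] 0) (𝓝 w)) :
    Tendsto (fun t : ℝ => (t ^ 2)⁻¹ * (φ (p t) - φ x)) (𝓝[>] 0)
      (𝓝 (fderiv ℝ φ x w + (1 / 2 : ℝ) * fderiv ℝ (fderiv ℝ φ) x d d)) := by
  have h0 : Tendsto (fun t : ℝ => t) (𝓝[>] 0) (𝓝 0) := nhdsWithin_le_nhds
  have h1 := tendsto_scaled_taylor_two hφ (v := fun t => p t - x) (ρ := fun t : ℝ => t)
    (l := 𝓝[>] 0) self_mem_nhdsWithin h0 (tendsto_arc_one hp)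
  have h2 := (((fderiv ℝ φ x).continuous.tendsto w).comp hp).add h1
  refine h2.congr' ?_
  filter_upwards [self_mem_nhdsWithin] with t ht
  simp only [Function.comp, map_smul, map_sub, smul_eq_mul, hd, add_sub_cancel]
  ring

theorem tendsto_of_arc {x d w : E} {p : ℝ → E}
    (hp : Tendsto (fun t : ℝ => (t ^ 2)⁻¹ • (p t - x - t • d)) (𝓝[>] 0) (𝓝 w)) :
    Tendsto p (𝓝[>] 0) (𝓝 x) := by
  have h0 : Tendsto (fun t : ℝ => t) (𝓝[>] 0) (𝓝 0) := nhdsWithin_le_nhds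
  have := (h0.smul (tendsto_arc_one hp)).add_const x
  rw [zero_smul, zero_add] at this
  refine this.congr' ?_
  filter_upwards [self_mem_nhdsWithin] with t ht
  have ht : t ≠ 0 := ne_of_gt ht
  rw [smul_inv_smul₀ ht, sub_add_cancel]

end Taylor

/-! ### Farkas' lemma and linear programming duality -/

/-- Induction on the number of inequalities. If inequality `k` is not redundant, some `x₀` violates
it while satisfying the others and making `f` negative; projecting along `x₀` onto the kernel of `g
k` eliminates it. The argument is purely algebraic, so `V` carries no topology and may have any
dimension. -/
theorem farkas_finset {V ι : Type*} [AddCommGroup V] [Module ℝ V] (s : Finset ι) :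
    ∀ (g : ι → V →ₗ[ℝ] ℝ) (f : V →ₗ[ℝ] ℝ),
      (∀ x, (∀ i ∈ s, 0 ≤ g i x) → 0 ≤ f x) →
      ∃ c : ι → ℝ, (∀ i, 0 ≤ c i) ∧ f = ∑ i ∈ s, c i • g i := by
  classical
  induction s using Finset.induction_on with
  | empty =>
    intro g f hf
    refine ⟨0, fun _ => le_rfl, ?_⟩
    ext x
    have h1 := hf x (by simp)
    have h2 := hf (-x) (by simp)
    rw [map_neg] at h2
    simp
    linarith
  | insert k s hk ih =>
    intro g f hf
    by_cases hcase : ∀ x, (∀ i ∈ s, 0 ≤ g i x) → 0 ≤ f x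
    · obtain ⟨c, hc, hcf⟩ := ih g f hcase
      refine ⟨Function.update c k 0, fun i => ?_, ?_⟩
      · by_cases h : i = k
        · subst h; simp
        · simp [h, hc]
      · rw [Finset.sum_insert hk, hcf]
        simp only [Function.update_self, zero_smul, zero_add]
        refine Finset.sum_congr rfl fun i hi => ?_
        rw [Function.update_of_ne (by rintro rfl; exact hk hi)]
    · push Not at hcase
      obtain ⟨x₁, hx₁, hfx₁⟩ := hcase
      have hneg : g k x₁ < 0 := by
        by_contra h
        push Not at h
        exact absurd (hf x₁ (by simpa [h] using hx₁)) (not_le.2 hfx₁)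
      -- Normalised so that `g k x₀ = -1`, hence `x + g k x • x₀` lies in the kernel of `g k`.
      set x₀ := (-(g k x₁)⁻¹) • x₁ with hx₀
      have hpos : 0 < -(g k x₁)⁻¹ := by simpa using hneg
      have hk0 : g k x₀ = -1 := by
        simp [hx₀, hneg.ne]
      have hs0 : ∀ i ∈ s, 0 ≤ g i x₀ := fun i hi => by
        rw [hx₀, map_smul]; exact mul_nonneg hpos.le (hx₁ i hi)
      have hf0 : f x₀ < 0 := by
        rw [hx₀, map_smul]; exact mul_neg_of_pos_of_neg hpos hfx₁
      obtain ⟨c, hc, hcf⟩ := ih (fun i => g i + g i x₀ • g k) (f + f x₀ • g k) (by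
        intro x hx
        have := hf (x + g k x • x₀) (by
          intro i hi
          rw [Finset.mem_insert] at hi
          rcases hi with rfl | hi
          · simp [hk0]
          · have := hx i hi
            simp at this ⊢
            linarith)
        simp at this ⊢
        linarith)
      -- The coefficient of `g k` after expanding `f + f x₀ • g k = ∑ c i • (g i + g i x₀ • g k)`;
      -- it is nonnegative since `f x₀ < 0`.
      refine ⟨Function.update c k (∑ i ∈ s, c i * g i x₀ - f x₀), fun i => ?_, ?_⟩
      · by_cases h : i = k
        · subst h
          have := Finset.sum_nonneg fun i hi => mul_nonneg (hc i) (hs0 i hi)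
          simp; linarith
        · simp [h, hc]
      · rw [Finset.sum_insert hk, Function.update_self]
        have : ∑ i ∈ s, Function.update c k (∑ i ∈ s, c i * g i x₀ - f x₀) i • g i
            = ∑ i ∈ s, c i • g i := by
          refine Finset.sum_congr rfl fun i hi => ?_
          rw [Function.update_of_ne (by rintro rfl; exact hk hi)]
        rw [this]
        ext x
        have := congrArg (fun F => F x) hcf
        simp [Finset.sum_add_distrib, Finset.sum_mul, sub_mul, mul_assoc] at this ⊢
        linarith

/-- A nonzero functional vanishing on the range would be a linear relation among the `A i`. -/
theorem surjective_pi_of_linearIndependent {V ι : Type*} [AddCommGroup V] [Module ℝ V] [Fintype ι]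
    {A : ι → V →ₗ[ℝ] ℝ} (hA : LinearIndependent ℝ A) : Function.Surjective (LinearMap.pi A) := by
  classical
  rw [← LinearMap.range_eq_top]
  by_contra h
  obtain ⟨f, hf, hle⟩ := Submodule.exists_le_ker_of_lt_top _ (lt_top_iff_ne_top.2 h)
  refine hf ?_
  have h0 : ∑ i, f (Pi.single i 1) • A i = 0 := by
    ext x
    have := hle ⟨x, rfl⟩
    rw [LinearMap.mem_ker, ← Finset.univ_sum_single (LinearMap.pi A x), map_sum] at this
    rw [LinearMap.zero_apply, ← this]
    simp only [LinearMap.sum_apply, LinearMap.smul_apply, LinearMap.pi_apply]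
    refine Finset.sum_congr rfl fun i _ => ?_
    rw [show Pi.single i (A i x) = A i x • (Pi.single i 1 : ι → ℝ) by
      rw [← Pi.single_smul]; simp, map_smul]
    simp [mul_comm]
  have := Fintype.linearIndependent_iff.1 hA _ h0
  refine LinearMap.pi_ext' fun i => ?_
  ext
  simpa using this i

/-- Linear programming duality under a Slater-type condition. -/
theorem exists_multiplier_of_forall_nonneg {V J I : Type*} [AddCommGroup V] [Module ℝ V]
    [Fintype J] [Fintype I] {A : J → V →ₗ[ℝ] ℝ} {B : I → V →ₗ[ℝ] ℝ} {α : J → ℝ} {β : I → ℝ}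
    {s : Set I} (hA : LinearIndependent ℝ A) {e : V} (hAe : ∀ j, A j e = 0)
    (hBe : ∀ i ∈ s, B i e < 0) {c : V →ₗ[ℝ] ℝ} {r : ℝ}
    (h : ∀ w, (∀ j, A j w + α j = 0) → (∀ i ∈ s, B i w + β i < 0) → 0 ≤ c w + r) :
    ∃ (u : J → ℝ) (v : I → ℝ), (∀ i, 0 ≤ v i) ∧ (∀ i ∉ s, v i = 0) ∧
      c + ∑ j, u j • A j + ∑ i, v i • B i = 0 ∧
      0 ≤ r + ∑ j, u j * α j + ∑ i, v i * β i := by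
  classical
  obtain ⟨w₁, hw₁⟩ := surjective_pi_of_linearIndependent hA (-α)
  have hw₁' : ∀ j, A j w₁ = -α j := fun j => by simpa using congrFun hw₁ j
  -- A Slater point: solve the equalities, then move far along `e`, which preserves them and drives
  -- every inequality in `s` to `-∞`.
  obtain ⟨w₀, hw₀A, hw₀B⟩ : ∃ w₀, (∀ j, A j w₀ = -α j) ∧ ∀ i ∈ s, B i w₀ + β i < 0 := by
    have : ∀ᶠ R : ℝ in atTop, ∀ i, i ∈ s → B i (w₁ + R • e) + β i < 0 := by
      rw [eventually_all]
      intro i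
      by_cases hi : i ∈ s
      · have h1 : Tendsto (fun R : ℝ => R * B i e) atTop atBot :=
          tendsto_id.atTop_mul_const_of_neg (hBe i hi)
        filter_upwards [h1.eventually_lt_atBot (-(B i w₁ + β i))] with R hR _
        simp
        linarith
      · simp [hi]
    obtain ⟨R, hR⟩ := this.exists
    exact ⟨w₁ + R • e, fun j => by simp [hAe, hw₁'], hR⟩
  -- Homogenisation: an affine function `l w + a` becomes the linear one `l w + a τ`, with the extra
  -- inequality `τ ≥ 0`. Equalities enter Farkas' lemma as pairs of opposite inequalities.
  let ext : (V →ₗ[ℝ] ℝ) → ℝ → (V × ℝ →ₗ[ℝ] ℝ) := fun l a => l.coprod (a • LinearMap.id)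
  have hext : ∀ l a w τ, ext l a (w, τ) = l w + a * τ := fun l a w τ => by simp [ext]
  let g : (J ⊕ J) ⊕ (I ⊕ Unit) → V × ℝ →ₗ[ℝ] ℝ :=
    Sum.elim (Sum.elim (fun j => ext (A j) (α j)) fun j => -ext (A j) (α j))
      (Sum.elim (fun i => if i ∈ s then -ext (B i) (β i) else 0) fun _ => ext 0 1)
  obtain ⟨k, hk, hkf⟩ := farkas_finset Finset.univ g (ext c r) (by
    rintro ⟨w, τ⟩ hx
    have hxA : ∀ j, A j w + α j * τ = 0 := fun j => by
      have h1 := hx (.inl (.inl j)) (Finset.mem_univ _)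
      have h2 := hx (.inl (.inr j)) (Finset.mem_univ _)
      simp only [g, Sum.elim_inl, Sum.elim_inr, LinearMap.neg_apply, hext] at h1 h2
      linarith
    have hxB : ∀ i ∈ s, B i w + β i * τ ≤ 0 := fun i hi => by
      have h1 := hx (.inr (.inl i)) (Finset.mem_univ _)
      simp only [g, Sum.elim_inl, Sum.elim_inr, hi, if_true, LinearMap.neg_apply, hext] at h1
      linarith
    have hτ : 0 ≤ τ := by
      have h1 := hx (.inr (.inr ())) (Finset.mem_univ _)
      simpa [g, hext] using h1
    rw [hext]
    -- Adding `ε` times the Slater point makes `τ + ε` positive and the inequalities strict, so `h`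
    -- applies after division, even when `τ = 0`; then `ε → 0`.
    have key : ∀ ε : ℝ, 0 < ε → 0 ≤ c w + r * τ + ε * (c w₀ + r) := by
      intro ε hε
      have hpos : 0 < τ + ε := by linarith
      have := h ((τ + ε)⁻¹ • (w + ε • w₀)) (fun j => by
        have := hxA j
        simp only [map_smul, map_add, smul_eq_mul, hw₀A]
        field_simp
        linarith) (fun i hi => by
        have h1 := hxB i hi
        have h2 := mul_neg_of_pos_of_neg hε (hw₀B i hi)
        simp only [map_smul, map_add, smul_eq_mul]
        rw [← mul_lt_mul_iff_right₀ hpos]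
        field_simp
        linarith)
      simp only [map_smul, map_add, smul_eq_mul] at this
      have := mul_nonneg hpos.le this
      field_simp at this
      linarith
    have hlim : Tendsto (fun ε : ℝ => c w + r * τ + ε * (c w₀ + r)) (𝓝[>] 0)
        (𝓝 (c w + r * τ + 0 * (c w₀ + r))) := by
      refine Tendsto.mono_left ?_ nhdsWithin_le_nhds
      exact Continuous.tendsto (by fun_prop) 0
    rw [zero_mul, add_zero] at hlim
    exact ge_of_tendsto hlim (by filter_upwards [self_mem_nhdsWithin] with ε hε using key ε hε))
  have hall : ∀ w τ, c w + r * τ = ∑ j, (k (.inl (.inl j)) - k (.inl (.inr j))) * (A j w + α j * τ)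
      - ∑ i, (if i ∈ s then k (.inr (.inl i)) else 0) * (B i w + β i * τ)
      + k (.inr (.inr ())) * τ := by
    intro w τ
    rw [← hext, hkf]
    simp only [LinearMap.sum_apply, LinearMap.add_apply, Fintype.sum_sum_type, g, Sum.elim_inl, Sum.elim_inr,
      LinearMap.smul_apply, LinearMap.neg_apply, hext, smul_eq_mul, sub_mul,
      Finset.sum_sub_distrib, Finset.univ_unique, Finset.sum_singleton]
    have : ∀ i, k (.inr (.inl i)) * (if i ∈ s then -ext (B i) (β i) else 0) (w, τ) =
        -((if i ∈ s then k (.inr (.inl i)) else 0) * (B i w + β i * τ)) := by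
      intro i
      split_ifs with hi <;> simp [hext]
      ring
    simp only [this, Finset.sum_neg_distrib, mul_neg]
    simp
    ring
  -- Farkas' lemma expresses `c` itself as the combination, so signs flip. Setting `τ = 0` gives
  -- stationarity; `(0, 1)` gives the inequality, whose slack is the coefficient of `τ`.
  refine ⟨fun j => k (.inl (.inr j)) - k (.inl (.inl j)),
    fun i => if i ∈ s then k (.inr (.inl i)) else 0, fun i => ?_, fun i hi => by simp [hi], ?_, ?_⟩
  · dsimp only; split_ifs
    exacts [hk _, le_rfl]
  · ext w
    have := hall w 0
    simp only [mul_zero, add_zero, sub_mul, Finset.sum_sub_distrib] at this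
    simp only [LinearMap.sum_apply, LinearMap.add_apply, LinearMap.smul_apply, smul_eq_mul,
      LinearMap.zero_apply, sub_mul, Finset.sum_sub_distrib]
    linarith
  · have := hall 0 1
    have h3 := hk (.inr (.inr ()))
    simp [sub_mul, Finset.sum_sub_distrib] at this ⊢
    linarith

/-! ### Metric regularity, feasible arcs and second-order multipliers -/

/-- Lyusternik's estimate: the quantitative surjection theorem, applied on a ball about `p` of
radius proportional to `‖f p‖`, covers a ball about `f p` that contains `0`. -/
theorem exists_zero_near_of_surjective {E F : Type*} [NormedAddCommGroup E] [NormedSpace ℝ E]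
    [CompleteSpace E] [NormedAddCommGroup F] [NormedSpace ℝ F] [CompleteSpace F]
    {f : E → F} {f' : E →L[ℝ] F} {x : E} (hf : HasStrictFDerivAt f f' x)
    (hsurj : f'.range = ⊤) (hx : f x = 0) :
    ∃ K : ℝ, 0 < K ∧ ∀ᶠ p in 𝓝 x, ∃ y, f y = 0 ∧ ‖y - p‖ ≤ K * ‖f p‖ := by
  set R := f'.nonlinearRightInverseOfSurjective hsurj
  have hN : 0 < R.nnnorm := f'.nonlinearRightInverseOfSurjective_nnnorm_pos hsurj
  -- Half the admissible approximation constant, so the covering rate `R⁻¹ - c` is again `c`.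
  set c : NNReal := R.nnnorm⁻¹ / 2 with hc
  have hcpos : 0 < c := by positivity
  obtain ⟨s, hs, happ⟩ := hf.approximates_deriv_on_nhds (Or.inr hcpos)
  obtain ⟨δ, hδ, hball⟩ := Metric.mem_nhds_iff.1 hs
  have hcR : (0 : ℝ) < c := by exact_mod_cast hcpos
  have hsub : (R.nnnorm : ℝ)⁻¹ - c = c := by
    have : (R.nnnorm : ℝ)⁻¹ = 2 * c := by rw [hc]; push_cast; ring
    rw [this]; ring
  refine ⟨(c : ℝ)⁻¹, by positivity, ?_⟩
  have hcont : Tendsto (fun p => ‖p - x‖ + (c : ℝ)⁻¹ * ‖f p‖) (𝓝 x) (𝓝 0) := by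
    have h1 : Tendsto (fun p => ‖p - x‖) (𝓝 x) (𝓝 ‖x - x‖) :=
      (by fun_prop : Continuous fun p : E => ‖p - x‖).tendsto x
    have h2 := h1.add (hf.continuousAt.norm.tendsto.const_mul (c : ℝ)⁻¹)
    simpa [hx] using h2
  filter_upwards [hcont.eventually_lt_const hδ] with p hp
  have hsurjOn := happ.surjOn_closedBall_of_nonlinearRightInverse R (b := p)
    (ε := (c : ℝ)⁻¹ * ‖f p‖) (by positivity) (fun y hy => hball (by
      rw [Metric.mem_closedBall, dist_eq_norm] at hy
      rw [Metric.mem_ball, dist_eq_norm]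
      have := norm_add_le (y - p) (p - x)
      rw [sub_add_sub_cancel] at this
      linarith))
  obtain ⟨y, hy, hy0⟩ := hsurjOn (show (0 : F) ∈ _ by
    rw [hsub, mul_inv_cancel_left₀ hcR.ne', Metric.mem_closedBall, dist_zero_left])
  exact ⟨y, hy0, by rwa [Metric.mem_closedBall, dist_eq_norm] at hy⟩

section SecondOrder

variable {E J I : Type*} [NormedAddCommGroup E] [NormedSpace ℝ E] [CompleteSpace E]
  [Fintype J] [Fintype I]

/-- On the parabola `x + t d + t² w` the equality residual is `o(t²)` by `hwa`, so metric regularity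
corrects it by `o(t²)` without changing `w`. Strictness in `hwb` absorbs this error in the
inequalities. -/
theorem exists_arc_of_second_order_tangent {a : J → E → ℝ} {b : I → E → ℝ} {x d w : E}
    (ha : ∀ j, ContDiffAt ℝ 2 (a j) x) (hb : ∀ i, ContDiffAt ℝ 2 (b i) x)
    (ha0 : ∀ j, a j x = 0) (hb0 : ∀ i, b i x ≤ 0)
    (hli : LinearIndependent ℝ fun j => (fderiv ℝ (a j) x : E →ₗ[ℝ] ℝ))
    (hda : ∀ j, fderiv ℝ (a j) x d = 0) (hdb : ∀ i, b i x = 0 → fderiv ℝ (b i) x d ≤ 0)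
    (hwa : ∀ j, fderiv ℝ (a j) x w + (1 / 2 : ℝ) * fderiv ℝ (fderiv ℝ (a j)) x d d = 0)
    (hwb : ∀ i, b i x = 0 → fderiv ℝ (b i) x d = 0 →
      fderiv ℝ (b i) x w + (1 / 2 : ℝ) * fderiv ℝ (fderiv ℝ (b i)) x d d < 0) :
    ∃ p : ℝ → E, Tendsto (fun t : ℝ => (t ^ 2)⁻¹ • (p t - x - t • d)) (𝓝[>] 0) (𝓝 w) ∧
      ∀ᶠ t in 𝓝[>] 0, (∀ j, a j (p t) = 0) ∧ ∀ i, b i (p t) ≤ 0 := by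
  classical
  let q : ℝ → E := fun t => x + t • d + t ^ 2 • w
  have hq : Tendsto (fun t : ℝ => (t ^ 2)⁻¹ • (q t - x - t • d)) (𝓝[>] 0) (𝓝 w) := by
    refine tendsto_const_nhds.congr' ?_
    filter_upwards [self_mem_nhdsWithin] with t ht
    have ht : t ≠ 0 := ne_of_gt ht
    have : q t - x - t • d = t ^ 2 • w := by simp only [q]; abel
    rw [this, inv_smul_smul₀ (pow_ne_zero 2 ht)]
  let F : E → J → ℝ := fun y j => a j y
  have hF : HasStrictFDerivAt F (ContinuousLinearMap.pi fun j => fderiv ℝ (a j) x) x :=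
    hasStrictFDerivAt_pi.2 fun j => (ha j).hasStrictFDerivAt (by simp)
  obtain ⟨K, hK, hnear⟩ := exists_zero_near_of_surjective hF
    (LinearMap.range_eq_top.2 (surjective_pi_of_linearIndependent hli)) (funext ha0)
  have hex := (tendsto_of_arc hq).eventually hnear
  have hsk : ∀ t, ∃ y, (∃ z, F z = 0 ∧ ‖z - q t‖ ≤ K * ‖F (q t)‖) →
      F y = 0 ∧ ‖y - q t‖ ≤ K * ‖F (q t)‖ := fun t => by
    by_cases h : ∃ z, F z = 0 ∧ ‖z - q t‖ ≤ K * ‖F (q t)‖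
    · obtain ⟨z, hz⟩ := h
      exact ⟨z, fun _ => hz⟩
    · exact ⟨0, fun h' => absurd h' h⟩
  choose p hp using hsk
  have hFq : Tendsto (fun t : ℝ => (t ^ 2)⁻¹ • F (q t)) (𝓝[>] 0) (𝓝 0) := by
    rw [tendsto_pi_nhds]
    intro j
    have := tendsto_arc_taylor (ha j) (hda j) hq
    rw [hwa j] at this
    simpa [F, ha0] using this
  have hpq : Tendsto (fun t : ℝ => (t ^ 2)⁻¹ • (p t - q t)) (𝓝[>] 0) (𝓝 0) := by
    have h1 := hFq.norm.const_mul K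
    rw [norm_zero, mul_zero] at h1
    refine squeeze_zero_norm' ?_ h1
    filter_upwards [hex] with t ht
    have := (hp t ht).2
    rw [norm_smul, norm_smul, mul_left_comm]
    gcongr
  have hparc : Tendsto (fun t : ℝ => (t ^ 2)⁻¹ • (p t - x - t • d)) (𝓝[>] 0) (𝓝 w) := by
    have := hpq.add hq
    rw [zero_add] at this
    refine this.congr fun t => ?_
    rw [← smul_add]
    congr 1
    abel
  refine ⟨p, hparc, ?_⟩
  -- Inactive constraints persist by continuity, those decreasing along `d` by the first-order term,
  -- the remaining ones by the second-order term.
  have hbev : ∀ᶠ t in 𝓝[>] 0, ∀ i, b i (p t) ≤ 0 := by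
    rw [eventually_all]
    intro i
    rcases (hb0 i).lt_or_eq with hi | hi
    · have := ((hb i).continuousAt.tendsto.comp (tendsto_of_arc hparc)).eventually_lt_const hi
      filter_upwards [this] with t ht using ht.le
    rcases (hdb i hi).lt_or_eq with hi' | hi'
    · have h0 : Tendsto (fun t : ℝ => t) (𝓝[>] 0) (𝓝 0) := nhdsWithin_le_nhds
      have := tendsto_scaled_taylor_one ((hb i).differentiableAt (by simp))
        (l := 𝓝[>] 0) self_mem_nhdsWithin h0 (tendsto_arc_one hparc)
      filter_upwards [this.eventually_lt_const hi', self_mem_nhdsWithin] with t ht ht0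
      rw [add_sub_cancel, hi, sub_zero] at ht
      exact (neg_of_mul_neg_right ht (inv_pos.2 ht0).le).le
    · have := tendsto_arc_taylor (hb i) hi' hparc
      filter_upwards [this.eventually_lt_const (hwb i hi hi'), self_mem_nhdsWithin] with t ht ht0
      rw [hi, sub_zero] at ht
      exact (neg_of_mul_neg_right ht (inv_pos.2 (pow_pos ht0 2)).le).le
  filter_upwards [hex, hbev] with t ht ht'
  exact ⟨fun j => congrFun (hp t ht).1 j, ht'⟩

/-- Second-order necessary conditions under the Mangasarian-Fromovitz qualification. -/
theorem exists_multiplier_second_order {a : J → E → ℝ} {b : I → E → ℝ} {x d e : E}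
    (ha : ∀ j, ContDiffAt ℝ 2 (a j) x) (hb : ∀ i, ContDiffAt ℝ 2 (b i) x)
    (ha0 : ∀ j, a j x = 0) (hb0 : ∀ i, b i x ≤ 0)
    (hli : LinearIndependent ℝ fun j => (fderiv ℝ (a j) x : E →ₗ[ℝ] ℝ))
    (hea : ∀ j, fderiv ℝ (a j) x e = 0) (heb : ∀ i, b i x = 0 → fderiv ℝ (b i) x e < 0)
    (hda : ∀ j, fderiv ℝ (a j) x d = 0) (hdb : ∀ i, b i x = 0 → fderiv ℝ (b i) x d ≤ 0)
    {c : E →ₗ[ℝ] ℝ} {r : ℝ}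
    (harc : ∀ (w : E) (p : ℝ → E),
      Tendsto (fun t : ℝ => (t ^ 2)⁻¹ • (p t - x - t • d)) (𝓝[>] 0) (𝓝 w) →
      (∀ᶠ t in 𝓝[>] 0, (∀ j, a j (p t) = 0) ∧ ∀ i, b i (p t) ≤ 0) → 0 ≤ c w + r) :
    ∃ (u : J → ℝ) (v : I → ℝ), (∀ i, 0 ≤ v i) ∧ (∀ i, b i x ≠ 0 → v i = 0) ∧
      (∀ w, c w + ∑ j, u j * fderiv ℝ (a j) x w + ∑ i, v i * fderiv ℝ (b i) x w = 0) ∧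
      0 ≤ r + ∑ j, u j * ((1 / 2 : ℝ) * fderiv ℝ (fderiv ℝ (a j)) x d d)
        + ∑ i, v i * ((1 / 2 : ℝ) * fderiv ℝ (fderiv ℝ (b i)) x d d) := by
  -- Only active inequalities with zero derivative along `d` restrict `w`.
  obtain ⟨u, v, hv, hv0, hst, hr⟩ := exists_multiplier_of_forall_nonneg (c := c) (r := r)
    (B := fun i => (fderiv ℝ (b i) x : E →ₗ[ℝ] ℝ)) (s := {i | b i x = 0 ∧ fderiv ℝ (b i) x d = 0})
    (α := fun j => (1 / 2 : ℝ) * fderiv ℝ (fderiv ℝ (a j)) x d d)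
    (β := fun i => (1 / 2 : ℝ) * fderiv ℝ (fderiv ℝ (b i)) x d d)
    hli hea (fun i hi => heb i hi.1) (fun w hwa hwb => by
      obtain ⟨p, hp, hpf⟩ := exists_arc_of_second_order_tangent ha hb ha0 hb0 hli hda hdb hwa
        fun i hi hi' => hwb i ⟨hi, hi'⟩
      exact harc w p hp hpf)
  refine ⟨u, v, hv, fun i hi => hv0 i fun h => hi h.1, fun w => ?_, hr⟩
  simpa using congrArg (fun l => l w) hst

end SecondOrder

/-- The multiplier set of a first-order system satisfying the Mangasarian-Fromovitz
qualification is bounded. -/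
theorem isBounded_multipliers {E J I : Type*} [NormedAddCommGroup E] [InnerProductSpace ℝ E]
    [FiniteDimensional ℝ E] [Fintype J] [Fintype I] {A : J → E} {B : I → E}
    (hA : LinearIndependent ℝ A) {s : Set I} {e : E} (hAe : ∀ j, inner ℝ (A j) e = 0)
    (hBe : ∀ i ∈ s, inner ℝ (B i) e < 0) (c : E) :
    ∃ R : ℝ, ∀ (u : J → ℝ) (v : I → ℝ), (∀ i, 0 ≤ v i) → (∀ i ∉ s, v i = 0) →
      c + ∑ j, u j • A j + ∑ i, v i • B i = 0 → (∀ j, |u j| ≤ R) ∧ ∀ i, |v i| ≤ R := by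
  classical
  have hv : ∀ i, ∃ R : ℝ, ∀ (u : J → ℝ) (v : I → ℝ), (∀ i, 0 ≤ v i) → (∀ i ∉ s, v i = 0) →
      c + ∑ j, u j • A j + ∑ i, v i • B i = 0 → |v i| ≤ R := by
    intro i
    by_cases hi : i ∈ s
    -- Pairing stationarity with `e` removes the equality terms; all other terms `v k * ⟨B k, e⟩`
    -- are nonpositive, which bounds each one separately.
    · refine ⟨inner ℝ c e / (-inner ℝ (B i) e), fun u v hv hvs h => ?_⟩
      have h1 := congrArg (fun y => inner ℝ y e) h
      simp only [inner_add_left, sum_inner, inner_smul_left, hAe, inner_zero_left] at h1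
      simp at h1
      have h2 : ∑ k, v k * inner ℝ (B k) e ≤ v i * inner ℝ (B i) e := by
        rw [← Finset.add_sum_erase _ _ (Finset.mem_univ i)]
        have : ∑ k ∈ Finset.univ.erase i, v k * inner ℝ (B k) e ≤ 0 :=
          Finset.sum_nonpos fun k _ => by
            by_cases hk : k ∈ s
            · exact mul_nonpos_of_nonneg_of_nonpos (hv k) (hBe k hk).le
            · simp [hvs k hk]
        linarith
      rw [abs_of_nonneg (hv i), le_div_iff₀ (by linarith [hBe i hi])]
      linarith
    · exact ⟨0, fun u v _ hvs _ => by simp [hvs i hi]⟩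
  choose R hR using hv
  -- Independence of `A` recovers a bound on `u` from one on `∑ u j • A j`, which stationarity
  -- expresses through `c` and `v`.
  obtain ⟨K, hK, hanti⟩ := LinearMap.exists_antilipschitzWith (Fintype.linearCombination ℝ A)
    (LinearMap.ker_eq_bot.2 hA.fintypeLinearCombination_injective)
  refine ⟨max (∑ i, |R i|) (K * (‖c‖ + ∑ i, |R i| * ‖B i‖)), fun u v h1 h2 h3 => ⟨fun j => ?_, fun i => ?_⟩⟩
  · refine le_trans ?_ (le_max_right _ _)
    have h4 := hanti.le_mul_dist u 0
    rw [map_zero, dist_zero_right, dist_zero_right, Fintype.linearCombination_apply] at h4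
    have h5 : ∑ j, u j • A j = -(c + ∑ i, v i • B i) := by
      rw [eq_neg_iff_add_eq_zero, ← h3]; abel
    have h6 : ‖c + ∑ i, v i • B i‖ ≤ ‖c‖ + ∑ i, |R i| * ‖B i‖ := by
      refine (norm_add_le _ _).trans (add_le_add_right ((norm_sum_le _ _).trans ?_) _)
      refine Finset.sum_le_sum fun i _ => ?_
      rw [norm_smul, Real.norm_eq_abs]
      have := (hR i u v h1 h2 h3).trans (le_abs_self _)
      gcongr
    rw [h5, norm_neg] at h4
    refine (norm_le_pi_norm u j).trans (h4.trans ?_)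
    gcongr
  · refine le_trans ((hR i u v h1 h2 h3).trans (le_abs_self _)) (le_trans ?_ (le_max_left _ _))
    exact Finset.single_le_sum (f := fun i => |R i|) (fun i _ => abs_nonneg _) (Finset.mem_univ i)

/-! ### Limiting directions of lower-level responses -/

/-- Along a second-order arc in the upper variable, responses in the lower variable that do not
decrease the Lagrangian and nearly satisfy the constraints have a limiting direction `e`, at which
the linearised constraints and the second-order inequality hold. -/
theorem exists_direction_of_arc_response {X Z κ : Type*} [NormedAddCommGroup X] [NormedSpace ℝ X]
    [NormedAddCommGroup Z] [NormedSpace ℝ Z] [FiniteDimensional ℝ Z]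
    {L : X × Z → ℝ} {k : κ → X × Z → ℝ} {x d w : X} {z : Z}
    (hL : ContDiffAt ℝ 2 L (x, z)) (hk : ∀ i, DifferentiableAt ℝ (k i) (x, z))
    (hk0 : ∀ i, k i (x, z) = 0) (hLz : ∀ e, fderiv ℝ L (x, z) (0, e) = 0)
    (hLd : fderiv ℝ L (x, z) (d, 0) = 0)
    (hneg : ∀ e, e ≠ 0 → (∀ i, fderiv ℝ (k i) (x, z) (0, e) = 0) →
      fderiv ℝ (fderiv ℝ L) (x, z) (0, e) (0, e) < 0)
    {p : ℝ → X} (hp : Tendsto (fun t : ℝ => (t ^ 2)⁻¹ • (p t - x - t • d)) (𝓝[>] 0) (𝓝 w))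
    {q : ℝ → Z} (hq : Tendsto q (𝓝[>] 0) (𝓝 z))
    (hinc : ∀ᶠ t in 𝓝[>] 0, L (x, z) ≤ L (p t, q t))
    {σ : κ → ℝ} (hσ : ∀ i, 0 < σ i)
    (hkq : ∀ i, ∀ᶠ t in 𝓝[>] 0, σ i * |k i (p t, q t)| ≤ L (p t, q t) - L (x, z)) :
    ∃ e, (∀ i, fderiv ℝ (k i) (x, z) (d, e) = 0) ∧
      0 ≤ fderiv ℝ L (x, z) (w, 0) +
        (1 / 2 : ℝ) * fderiv ℝ (fderiv ℝ L) (x, z) (d, e) (d, e) := by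
  -- Along an ultrafilter bounded scaled displacements converge, which replaces passing to
  -- subsequences.
  let U : Ultrafilter ℝ := Ultrafilter.of (𝓝[>] 0)
  have hU : (U : Filter ℝ) ≤ 𝓝[>] 0 := Ultrafilter.of_le _
  have hpos : ∀ᶠ t : ℝ in U, 0 < t := hU self_mem_nhdsWithin
  have h0 : Tendsto (fun t : ℝ => t) U (𝓝 0) := hU.trans nhdsWithin_le_nhds
  let ρ : ℝ → ℝ := fun t => t + ‖q t - z‖
  have hρ : ∀ᶠ t in U, 0 < ρ t := by
    filter_upwards [hpos] with t ht
    have := norm_nonneg (q t - z)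
    simp only [ρ]; linarith
  have hρ0 : Tendsto ρ U (𝓝 0) := by
    have h1 := ((hq.mono_left hU).sub_const z).norm
    rw [sub_self, norm_zero] at h1
    simpa using h0.add h1
  obtain ⟨⟨τ, e⟩, -, hlim⟩ : ∃ y ∈ Metric.closedBall (0 : ℝ × Z) 1,
      Tendsto (fun t => ((ρ t)⁻¹ * t, (ρ t)⁻¹ • (q t - z))) U (𝓝 y) := by
    refine (isCompact_closedBall (0 : ℝ × Z) 1).ultrafilter_le_nhds (U.map _) ?_
    rw [Filter.le_principal_iff]
    change ∀ᶠ t in (U : Filter ℝ), _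
    filter_upwards [hpos, hρ] with t ht hρt
    rw [mem_closedBall_zero_iff, Prod.norm_def, max_le_iff]
    have h1 := norm_nonneg (q t - z)
    constructor
    · rw [Real.norm_of_nonneg (by positivity), inv_mul_le_iff₀ hρt]
      simp only [ρ]; linarith
    · rw [norm_smul, Real.norm_of_nonneg (by positivity), inv_mul_le_iff₀ hρt]
      simp only [ρ]; linarith
  have hτ : Tendsto (fun t => (ρ t)⁻¹ * t) U (𝓝 τ) := (continuous_fst.tendsto _).comp hlim
  have he : Tendsto (fun t => (ρ t)⁻¹ • (q t - z)) U (𝓝 e) := (continuous_snd.tendsto _).comp hlim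
  -- The choice of `ρ` guarantees that the limit is nonzero.
  have hsum : τ + ‖e‖ = 1 := by
    refine tendsto_nhds_unique (hτ.add he.norm) (tendsto_const_nhds.congr' ?_)
    filter_upwards [hρ] with t ht
    rw [norm_smul, Real.norm_of_nonneg (inv_nonneg.2 ht.le), ← mul_add]
    exact (inv_mul_cancel₀ ht.ne').symm
  have hτ0 : 0 ≤ τ := ge_of_tendsto hτ (by
    filter_upwards [hpos, hρ] with t ht hρt using by positivity)
  let v : ℝ → X × Z := fun t => (p t - x, q t - z)
  have hadd : ∀ t, (x, z) + v t = (p t, q t) := fun t => by simp [v]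
  have hv : Tendsto (fun t => (ρ t)⁻¹ • v t) U (𝓝 (τ • d, e)) := by
    refine Tendsto.prodMk_nhds ?_ he
    refine (hτ.smul ((tendsto_arc_one hp).mono_left hU)).congr' ?_
    filter_upwards [hpos] with t ht
    rw [smul_smul, mul_assoc, mul_inv_cancel₀ ht.ne', mul_one]
  have hDL : ∀ (y : X) (s : Z), fderiv ℝ L (x, z) (y, s) = fderiv ℝ L (x, z) (y, 0) := by
    intro y s
    have : ((y, s) : X × Z) = (y, 0) + (0, s) := by simp
    rw [this, map_add, hLz, add_zero]
  -- The first-order term is itself of order `t²`: `DL` vanishes on lower directions and on `(d,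
  -- 0)`, leaving only the contribution of `t² w`.
  have hLlim : Tendsto (fun t => (ρ t ^ 2)⁻¹ * (L (p t, q t) - L (x, z))) U
      (𝓝 (τ ^ 2 * fderiv ℝ L (x, z) (w, 0) +
        (1 / 2 : ℝ) * fderiv ℝ (fderiv ℝ L) (x, z) (τ • d, e) (τ • d, e))) := by
    have h1 := tendsto_scaled_taylor_two hL hρ hρ0 hv
    have hc : Continuous fun y : X => fderiv ℝ L (x, z) (y, 0) := by fun_prop
    have h2 := (hτ.pow 2).mul ((hc.tendsto w).comp (hp.mono_left hU))
    refine (h2.add h1).congr' ?_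
    filter_upwards [hpos] with t ht
    have e1 : fderiv ℝ L (x, z) (v t) = fderiv ℝ L (x, z) (p t - x, 0) := hDL _ _
    have e2 : fderiv ℝ L (x, z) ((t ^ 2)⁻¹ • (p t - x - t • d), 0) =
        (t ^ 2)⁻¹ * fderiv ℝ L (x, z) (p t - x, 0) := by
      have : (((t ^ 2)⁻¹ • (p t - x - t • d), 0) : X × Z) =
        (t ^ 2)⁻¹ • ((p t - x, 0) - t • (d, 0)) := by simp
      rw [this, map_smul, map_sub, map_smul, hLd]
      simp
    simp only [Function.comp, hadd, e1, e2]
    rw [mul_pow, inv_pow]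
    field_simp
    ring
  have hge := ge_of_tendsto hLlim (by
    filter_upwards [hU hinc] with t ht using mul_nonneg (by positivity) (sub_nonneg.2 ht))
  -- By `hkq` each constraint is bounded by a multiple of the Lagrangian gain, which is `O(ρ²)`;
  -- hence its quotient by `ρ` tends to `0`.
  have hkd : ∀ i, fderiv ℝ (k i) (x, z) (τ • d, e) = 0 := by
    intro i
    have h1 := tendsto_scaled_taylor_one (hk i) hρ hρ0 hv
    refine tendsto_nhds_unique h1 ?_
    have h2 := (hρ0.mul hLlim).const_mul (σ i)⁻¹
    rw [zero_mul, mul_zero] at h2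
    refine squeeze_zero_norm' ?_ h2
    filter_upwards [hU (hkq i), hρ] with t ht hρt
    rw [hadd, hk0, sub_zero, norm_mul, Real.norm_of_nonneg (inv_nonneg.2 hρt.le), Real.norm_eq_abs]
    have h3 : |k i (p t, q t)| ≤ (σ i)⁻¹ * (L (p t, q t) - L (x, z)) := by
      rwa [le_inv_mul_iff₀ (hσ i)]
    calc (ρ t)⁻¹ * |k i (p t, q t)| ≤ (ρ t)⁻¹ * ((σ i)⁻¹ * (L (p t, q t) - L (x, z))) := by gcongr
      _ = _ := by field_simp
  -- If `τ = 0`, then `e` is a unit vector killed by the linearised constraints with nonnegative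
  -- curvature, against `hneg`. Otherwise divide by `τ`.
  rcases hτ0.eq_or_lt with h | h
  · exfalso
    subst h
    have he0 : e ≠ 0 := by
      rintro rfl
      simp at hsum
    have := hneg e he0 (fun i => by simpa using hkd i)
    simp only [zero_smul] at hge
    linarith
  · have hsc : ((τ • d, e) : X × Z) = τ • (d, τ⁻¹ • e) := by
      simp [smul_inv_smul₀ h.ne']
    refine ⟨τ⁻¹ • e, fun i => ?_, ?_⟩
    · have := hkd i
      rw [hsc, map_smul, smul_eq_mul] at this
      exact (mul_eq_zero.1 this).resolve_left h.ne'
    · rw [hsc] at hge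
      simp only [map_smul, _root_.smul_apply, smul_eq_mul] at hge
      have h2 : 0 < τ ^ 2 := by positivity
      refine nonneg_of_mul_nonneg_right (b := _) (a := τ ^ 2) ?_ h2
      linarith

/-! ### Saddle-point matrices and the Schur complement -/

section SaddleMatrix

variable {ν κ ξ : Type*} [Fintype ν] [Fintype κ] [Fintype ξ] [DecidableEq ν] [DecidableEq κ]

/-- For a kernel vector `(y, s)`, pairing the first block row with `y` gives `yᵀSy = -(Ay)ᵀs = 0`,
so `y = 0`; then `Aᵀs = 0` forces `s = 0`. -/
theorem isUnit_det_saddle {S : Matrix ν ν ℝ} {A : Matrix κ ν ℝ}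
    (hS : ∀ y, A *ᵥ y = 0 → y ≠ 0 → y ⬝ᵥ S *ᵥ y < 0) (hA : ∀ s, Aᵀ *ᵥ s = 0 → s = 0) :
    IsUnit (Matrix.fromBlocks S Aᵀ A 0).det := by
  rw [← Matrix.isUnit_iff_isUnit_det, ← Matrix.mulVec_injective_iff_isUnit]
  refine (injective_iff_map_eq_zero (Matrix.mulVecLin (Matrix.fromBlocks S Aᵀ A 0))).2 fun x hx => ?_
  rw [Matrix.mulVecLin_apply, Matrix.fromBlocks_mulVec] at hx
  have h1 : S *ᵥ (x ∘ Sum.inl) + Aᵀ *ᵥ (x ∘ Sum.inr) = 0 := funext fun i => congrFun hx (.inl i)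
  have h2 : A *ᵥ (x ∘ Sum.inl) = 0 := by
    have : A *ᵥ (x ∘ Sum.inl) + (0 : Matrix κ κ ℝ) *ᵥ (x ∘ Sum.inr) = 0 :=
      funext fun i => congrFun hx (.inr i)
    simpa using this
  have h3 : x ∘ Sum.inl = 0 := by
    by_contra hne
    have := hS _ h2 hne
    rw [eq_neg_of_add_eq_zero_left h1, dotProduct_neg, Matrix.dotProduct_mulVec,
      Matrix.vecMul_transpose, h2, zero_dotProduct] at this
    simp at this
  rw [h3, Matrix.mulVec_zero, zero_add] at h1
  have h4 := hA _ h1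
  ext (i | i)
  · exact congrFun h3 i
  · exact congrFun h4 i

/-- On the affine space of `e` with `B d + A e = 0` the left side is strictly concave. Its maximiser
is the first component of `-K⁻¹ N d`, where it equals the right side; moving by `k ∈ ker A` changes
it by exactly `kᵀSk ≤ 0`. -/
theorem quadratic_le_schur {S : Matrix ν ν ℝ} {A : Matrix κ ν ℝ} {R : Matrix ξ ξ ℝ}
    {T : Matrix ν ξ ℝ} {B : Matrix κ ξ ℝ} (hSsymm : Sᵀ = S)
    (hS : ∀ y, A *ᵥ y = 0 → y ≠ 0 → y ⬝ᵥ S *ᵥ y < 0) (hA : ∀ s, Aᵀ *ᵥ s = 0 → s = 0)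
    {d : ξ → ℝ} {e : ν → ℝ} (hde : B *ᵥ d + A *ᵥ e = 0) :
    d ⬝ᵥ R *ᵥ d + 2 * (e ⬝ᵥ T *ᵥ d) + e ⬝ᵥ S *ᵥ e ≤
      d ⬝ᵥ (R - (Matrix.fromRows T B)ᵀ * (Matrix.fromBlocks S Aᵀ A 0)⁻¹ * Matrix.fromRows T B) *ᵥ d := by
  set K := Matrix.fromBlocks S Aᵀ A (0 : Matrix κ κ ℝ) with hK
  set N := Matrix.fromRows T B with hN
  have hdet : IsUnit K.det := isUnit_det_saddle hS hA
  -- The blocks of `x` are the maximiser `y` and its multiplier `s`.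
  set x := -(K⁻¹ *ᵥ N *ᵥ d) with hx
  have hKx : K *ᵥ x = -(N *ᵥ d) := by
    rw [hx, Matrix.mulVec_neg, Matrix.mulVec_mulVec, Matrix.mul_nonsing_inv K hdet,
      Matrix.one_mulVec]
  have hNd : N *ᵥ d = Sum.elim (T *ᵥ d) (B *ᵥ d) := by rw [hN, Matrix.fromRows_mulVec]
  rw [hNd, hK, Matrix.fromBlocks_mulVec] at hKx
  set y := x ∘ Sum.inl
  set s := x ∘ Sum.inr
  have h1 : S *ᵥ y + Aᵀ *ᵥ s = -(T *ᵥ d) := funext fun i => congrFun hKx (.inl i)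
  have h2 : A *ᵥ y = -(B *ᵥ d) := by
    have : A *ᵥ y + (0 : Matrix κ κ ℝ) *ᵥ s = -(B *ᵥ d) := funext fun i => congrFun hKx (.inr i)
    simpa using this
  have hsch : d ⬝ᵥ (Nᵀ * K⁻¹ * N) *ᵥ d = -(y ⬝ᵥ T *ᵥ d + s ⬝ᵥ B *ᵥ d) := by
    have hxe : x = Sum.elim y s := by ext (i | i) <;> rfl
    rw [← Matrix.mulVec_mulVec, ← Matrix.mulVec_mulVec, Matrix.dotProduct_mulVec,
      Matrix.vecMul_transpose, show K⁻¹ *ᵥ N *ᵥ d = -x by rw [hx, neg_neg], dotProduct_neg, hNd,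
      hxe, sumElim_dotProduct_sumElim, dotProduct_comm y, dotProduct_comm s]
  obtain ⟨k, hk⟩ : ∃ k, e = y + k := ⟨e - y, by abel⟩
  have hAk : A *ᵥ k = 0 := by
    rw [hk, Matrix.mulVec_add, h2] at hde
    simpa using hde
  have hkk : k ⬝ᵥ S *ᵥ k ≤ 0 := by
    by_cases h : k = 0
    · simp [h]
    · exact (hS k hAk h).le
  have hsw : ∀ r, r ⬝ᵥ Aᵀ *ᵥ s = s ⬝ᵥ A *ᵥ r := fun r => by
    rw [Matrix.dotProduct_mulVec, Matrix.vecMul_transpose, dotProduct_comm]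
  have hTd : ∀ r, r ⬝ᵥ T *ᵥ d = -(r ⬝ᵥ S *ᵥ y) - s ⬝ᵥ A *ᵥ r := fun r => by
    rw [show T *ᵥ d = -(S *ᵥ y + Aᵀ *ᵥ s) by rw [h1, neg_neg], dotProduct_neg, dotProduct_add, hsw]
    ring
  have hBd : s ⬝ᵥ B *ᵥ d = -(s ⬝ᵥ A *ᵥ y) := by rw [h2, dotProduct_neg, neg_neg]
  have hyk : y ⬝ᵥ S *ᵥ k = k ⬝ᵥ S *ᵥ y := by
    rw [Matrix.dotProduct_mulVec, ← Matrix.mulVec_transpose, hSsymm, dotProduct_comm]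
  rw [Matrix.sub_mulVec, dotProduct_sub, hsch, hk]
  simp only [Matrix.mulVec_add, dotProduct_add, add_dotProduct, hTd, hBd, hyk, hAk,
    dotProduct_zero]
  linarith

end SaddleMatrix

/-! ### Gradients, Jacobians and Hessians as Fréchet derivatives -/

section Link

/-- The gradient is by definition the Riesz representative of `fderiv`, so differentiability is not
needed. -/
theorem inner_gradient_eq_fderiv {k : ℕ} (φ : Eu k → ℝ) (x d : Eu k) :
    inner ℝ (gradient φ x) d = fderiv ℝ φ x d :=
  InnerProductSpace.toDual_symm_apply

theorem gradient_apply_eq_fderiv {k : ℕ} (φ : Eu k → ℝ) (x : Eu k) (i : Fin k) :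
    gradient φ x i = fderiv ℝ φ x (EuclideanSpace.single i 1) := by
  rw [← inner_gradient_eq_fderiv, EuclideanSpace.inner_single_right]
  simp

theorem quad_eq_dotProduct {k : ℕ} (A : Matrix (Fin k) (Fin k) ℝ) (d : Eu k) :
    quad A d = d.ofLp ⬝ᵥ A *ᵥ d.ofLp := by
  rw [quad, EuclideanSpace.inner_eq_star_dotProduct]
  simp

theorem jac_apply_eq_fderiv {k l : ℕ} {F : Eu k → Eu l} {x : Eu k}
    (hF : ∀ i, DifferentiableAt ℝ (fun y => F y i) x) (i : Fin l) (j : Fin k) :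
    jac F x i j = fderiv ℝ (fun y => F y i) x (EuclideanSpace.single j 1) := by
  have h1 : DifferentiableAt ℝ F x := differentiableAt_euclidean.2 hF
  have h2 := ((EuclideanSpace.proj (𝕜 := ℝ) i).hasFDerivAt (x := F x)).comp x h1.hasFDerivAt
  have h3 : fderiv ℝ (fun y => F y i) x = _ := h2.fderiv
  rw [h3]
  rfl

theorem sum_smul_single {k : ℕ} (d : Eu k) : ∑ j, d j • EuclideanSpace.single j (1 : ℝ) = d := by
  ext i
  simp [Finset.sum_apply, Pi.single_apply]

theorem mulVec_eq_apply {κ : Type*} {k : ℕ} {M : Matrix κ (Fin k) ℝ} {ℓ : κ → Eu k →L[ℝ] ℝ}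
    (hM : ∀ i j, M i j = ℓ i (EuclideanSpace.single j 1)) (d : Eu k) (i : κ) :
    (M *ᵥ d.ofLp) i = ℓ i d := by
  conv_rhs => rw [← sum_smul_single d]
  simp [Matrix.mulVec, dotProduct, hM, mul_comm]

theorem dotProduct_mulVec_eq_apply {k l : ℕ} {M : Matrix (Fin l) (Fin k) ℝ}
    {D : Eu k →L[ℝ] Eu l →L[ℝ] ℝ}
    (hM : ∀ i j, M i j = D (EuclideanSpace.single j 1) (EuclideanSpace.single i 1))
    (d : Eu k) (e : Eu l) : e.ofLp ⬝ᵥ M *ᵥ d.ofLp = D d e := by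
  have h : ∀ i, (M *ᵥ d.ofLp) i = D d (EuclideanSpace.single i 1) := fun i =>
    mulVec_eq_apply (ℓ := fun i => D.flip (EuclideanSpace.single i 1)) (by simpa using hM) d i
  conv_rhs => rw [← sum_smul_single e]
  simp [dotProduct, h]

theorem hess_apply {k : ℕ} {φ : Eu k → ℝ} {x : Eu k} (hφ : ContDiffAt ℝ 2 φ x) (i j : Fin k) :
    hess φ x i j =
      fderiv ℝ (fderiv ℝ φ) x (EuclideanSpace.single j 1) (EuclideanSpace.single i 1) := by
  have h2 : DifferentiableAt ℝ (fderiv ℝ φ) x :=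
    (hφ.fderiv_right (m := 1) (by norm_num)).differentiableAt (by simp)
  have h3 : ∀ i : Fin k, HasFDerivAt (fun y => gradient φ y i)
      ((fderiv ℝ (fderiv ℝ φ) x).flip (EuclideanSpace.single i 1)) x := fun i => by
    simp only [gradient_apply_eq_fderiv]
    exact (h2.hasFDerivAt.clm_apply (hasFDerivAt_const _ x)).congr_fderiv (by ext; simp)
  rw [hess, jac_apply_eq_fderiv (fun i => (h3 i).differentiableAt), (h3 i).fderiv]
  rfl

theorem quad_hess {k : ℕ} {φ : Eu k → ℝ} {x : Eu k} (hφ : ContDiffAt ℝ 2 φ x) (d : Eu k) :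
    quad (hess φ x) d = fderiv ℝ (fderiv ℝ φ) x d d := by
  rw [quad_eq_dotProduct, dotProduct_mulVec_eq_apply (hess_apply hφ)]

theorem hess_transpose {k : ℕ} {φ : Eu k → ℝ} {x : Eu k} (hφ : ContDiffAt ℝ 2 φ x) :
    (hess φ x)ᵀ = hess φ x := by
  have hsymm : IsSymmSndFDerivAt ℝ φ x := hφ.isSymmSndFDerivAt (by simp)
  ext i j
  rw [Matrix.transpose_apply, hess_apply hφ, hess_apply hφ]
  exact hsymm.eq _ _

end Link

/-! ### Partial derivatives of functions on a product -/

section Partial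

variable {X Z : Type*} [NormedAddCommGroup X] [NormedSpace ℝ X] [NormedAddCommGroup Z]
  [NormedSpace ℝ Z] {F : X × Z → ℝ} {x : X} {z : Z}

theorem contDiffAt_partial_left {n : WithTop ℕ∞} (hF : ContDiffAt ℝ n F (x, z)) :
    ContDiffAt ℝ n (fun x' => F (x', z)) x :=
  hF.comp x (contDiffAt_id.prodMk contDiffAt_const)

theorem contDiffAt_partial_right {n : WithTop ℕ∞} (hF : ContDiffAt ℝ n F (x, z)) :
    ContDiffAt ℝ n (fun z' => F (x, z')) z :=
  hF.comp z (contDiffAt_const.prodMk contDiffAt_id)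

theorem fderiv_partial_left (hF : DifferentiableAt ℝ F (x, z)) (d : X) :
    fderiv ℝ (fun x' => F (x', z)) x d = fderiv ℝ F (x, z) (d, 0) := by
  have := HasFDerivAt.comp (f := fun x' : X => (x', z)) x hF.hasFDerivAt (hasFDerivAt_prodMk_left x z)
  have h : fderiv ℝ (fun x' => F (x', z)) x = _ := this.fderiv
  rw [h]; simp

theorem fderiv_partial_right (hF : DifferentiableAt ℝ F (x, z)) (d : Z) :
    fderiv ℝ (fun z' => F (x, z')) z d = fderiv ℝ F (x, z) (0, d) := by
  have := HasFDerivAt.comp (f := fun z' : Z => (x, z')) z hF.hasFDerivAt (hasFDerivAt_prodMk_right x z)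
  have h : fderiv ℝ (fun z' => F (x, z')) z = _ := this.fderiv
  rw [h]; simp

theorem eventually_differentiableAt (hF : ContDiffAt ℝ 2 F (x, z)) :
    ∀ᶠ p in 𝓝 (x, z), DifferentiableAt ℝ F p := by
  filter_upwards [hF.eventually (by simp)] with p hp using hp.differentiableAt (by simp)

theorem hasFDerivAt_fderiv (hF : ContDiffAt ℝ 2 F (x, z)) :
    HasFDerivAt (fderiv ℝ F) (fderiv ℝ (fderiv ℝ F) (x, z)) (x, z) :=
  ((hF.fderiv_right (m := 1) (by norm_num)).differentiableAt (by simp)).hasFDerivAt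

theorem fderiv_fderiv_partial_left (hF : ContDiffAt ℝ 2 F (x, z)) (d d' : X) :
    fderiv ℝ (fderiv ℝ fun x' => F (x', z)) x d d' =
      fderiv ℝ (fderiv ℝ F) (x, z) (d, 0) (d', 0) := by
  have hev : fderiv ℝ (fun x' => F (x', z)) =ᶠ[𝓝 x]
      fun x' => (fderiv ℝ F (x', z)).comp (ContinuousLinearMap.inl ℝ X Z) := by
    have hc : Tendsto (fun x' : X => (x', z)) (𝓝 x) (𝓝 (x, z)) :=
      Continuous.tendsto (by fun_prop) x
    filter_upwards [hc.eventually (eventually_differentiableAt hF)] with x' hx'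
    ext d
    rw [fderiv_partial_left hx']; simp
  have h1 := (HasFDerivAt.comp (f := fun x' : X => (x', z)) x (hasFDerivAt_fderiv hF)
    (hasFDerivAt_prodMk_left x z)).clm_comp
    (hasFDerivAt_const (ContinuousLinearMap.inl ℝ X Z) x)
  have h2 : fderiv ℝ (fun x' => (fderiv ℝ F (x', z)).comp (ContinuousLinearMap.inl ℝ X Z)) x = _ :=
    h1.fderiv
  rw [hev.fderiv_eq, h2]
  simp

theorem fderiv_fderiv_partial_right (hF : ContDiffAt ℝ 2 F (x, z)) (d d' : Z) :
    fderiv ℝ (fderiv ℝ fun z' => F (x, z')) z d d' =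
      fderiv ℝ (fderiv ℝ F) (x, z) (0, d) (0, d') := by
  have hev : fderiv ℝ (fun z' => F (x, z')) =ᶠ[𝓝 z]
      fun z' => (fderiv ℝ F (x, z')).comp (ContinuousLinearMap.inr ℝ X Z) := by
    have hc : Tendsto (fun z' : Z => (x, z')) (𝓝 z) (𝓝 (x, z)) :=
      Continuous.tendsto (by fun_prop) z
    filter_upwards [hc.eventually (eventually_differentiableAt hF)] with z' hz'
    ext d
    rw [fderiv_partial_right hz']; simp
  have h1 := (HasFDerivAt.comp (f := fun z' : Z => (x, z')) z (hasFDerivAt_fderiv hF)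
    (hasFDerivAt_prodMk_right x z)).clm_comp
    (hasFDerivAt_const (ContinuousLinearMap.inr ℝ X Z) z)
  have h2 : fderiv ℝ (fun z' => (fderiv ℝ F (x, z')).comp (ContinuousLinearMap.inr ℝ X Z)) z = _ :=
    h1.fderiv
  rw [hev.fderiv_eq, h2]
  simp

theorem hasFDerivAt_fderiv_partial_right (hF : ContDiffAt ℝ 2 F (x, z)) (e : Z) :
    HasFDerivAt (fun x' => fderiv ℝ (fun z' => F (x', z')) z e)
      (((fderiv ℝ (fderiv ℝ F) (x, z)).comp (ContinuousLinearMap.inl ℝ X Z)).flip (0, e)) x := by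
  have hev : (fun x' => fderiv ℝ (fun z' => F (x', z')) z e) =ᶠ[𝓝 x]
      fun x' => fderiv ℝ F (x', z) (0, e) := by
    have hc : Tendsto (fun x' : X => (x', z)) (𝓝 x) (𝓝 (x, z)) :=
      Continuous.tendsto (by fun_prop) x
    filter_upwards [hc.eventually (eventually_differentiableAt hF)] with x' hx'
    rw [fderiv_partial_right hx']
  refine HasFDerivAt.congr_of_eventuallyEq ?_ hev
  exact ((HasFDerivAt.comp (f := fun x' : X => (x', z)) x (hasFDerivAt_fderiv hF)
    (hasFDerivAt_prodMk_left x z)).clm_apply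
    (hasFDerivAt_const ((0, e) : X × Z) x)).congr_fderiv (by ext; simp)

end Partial

/-! ### Derivatives of Lagrangian combinations -/

section Combination

variable {E J I : Type*} [NormedAddCommGroup E] [NormedSpace ℝ E] [Fintype J] [Fintype I]
  {f : E → ℝ} {a : J → E → ℝ} {b : I → E → ℝ} {x : E}

theorem hasFDerivAt_lagrangian (hf : DifferentiableAt ℝ f x) (ha : ∀ j, DifferentiableAt ℝ (a j) x)
    (hb : ∀ i, DifferentiableAt ℝ (b i) x) (μ : J → ℝ) (lam : I → ℝ) :
    HasFDerivAt (fun y => f y + ∑ j, μ j * a j y - ∑ i, lam i * b i y)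
      (fderiv ℝ f x + ∑ j, μ j • fderiv ℝ (a j) x - ∑ i, lam i • fderiv ℝ (b i) x) x :=
  (hf.hasFDerivAt.add (HasFDerivAt.fun_sum fun j _ => (ha j).hasFDerivAt.const_mul (μ j))).sub
    (HasFDerivAt.fun_sum fun i _ => (hb i).hasFDerivAt.const_mul (lam i))

theorem contDiffAt_lagrangian (hf : ContDiffAt ℝ 2 f x) (ha : ∀ j, ContDiffAt ℝ 2 (a j) x)
    (hb : ∀ i, ContDiffAt ℝ 2 (b i) x) (μ : J → ℝ) (lam : I → ℝ) :
    ContDiffAt ℝ 2 (fun y => f y + ∑ j, μ j * a j y - ∑ i, lam i * b i y) x :=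
  (hf.add (ContDiffAt.sum fun j _ => contDiffAt_const.mul (ha j))).sub
    (ContDiffAt.sum fun i _ => contDiffAt_const.mul (hb i))

theorem fderiv_fderiv_lagrangian (hf : ContDiffAt ℝ 2 f x) (ha : ∀ j, ContDiffAt ℝ 2 (a j) x)
    (hb : ∀ i, ContDiffAt ℝ 2 (b i) x) (μ : J → ℝ) (lam : I → ℝ) (d d' : E) :
    fderiv ℝ (fderiv ℝ fun y => f y + ∑ j, μ j * a j y - ∑ i, lam i * b i y) x d d' =
      fderiv ℝ (fderiv ℝ f) x d d' + ∑ j, μ j * fderiv ℝ (fderiv ℝ (a j)) x d d'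
        - ∑ i, lam i * fderiv ℝ (fderiv ℝ (b i)) x d d' := by
  have hd : ∀ {φ : E → ℝ}, ContDiffAt ℝ 2 φ x → ∀ᶠ y in 𝓝 x, DifferentiableAt ℝ φ y := by
    intro φ hφ
    filter_upwards [hφ.eventually (by simp)] with y hy using hy.differentiableAt (by simp)
  have h2 : ∀ {φ : E → ℝ}, ContDiffAt ℝ 2 φ x →
      HasFDerivAt (fderiv ℝ φ) (fderiv ℝ (fderiv ℝ φ) x) x := fun hφ =>
    ((hφ.fderiv_right (m := 1) (by norm_num)).differentiableAt (by simp)).hasFDerivAt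
  have hev : (fderiv ℝ fun y => f y + ∑ j, μ j * a j y - ∑ i, lam i * b i y) =ᶠ[𝓝 x]
      fun y => fderiv ℝ f y + ∑ j, μ j • fderiv ℝ (a j) y - ∑ i, lam i • fderiv ℝ (b i) y := by
    filter_upwards [hd hf, eventually_all.2 fun j => hd (ha j), eventually_all.2 fun i => hd (hb i)]
      with y h1 h2 h3 using (hasFDerivAt_lagrangian h1 h2 h3 μ lam).fderiv
  have h := ((h2 hf).fun_add (HasFDerivAt.fun_sum (u := Finset.univ) fun j _ =>
      (h2 (ha j)).fun_const_smul (μ j))).fun_sub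
    (HasFDerivAt.fun_sum (u := Finset.univ) fun i _ => (h2 (hb i)).fun_const_smul (lam i))
  rw [hev.fderiv_eq]
  have h' : fderiv ℝ (fun y => fderiv ℝ f y + ∑ j, μ j • fderiv ℝ (a j) y -
    ∑ i, lam i • fderiv ℝ (b i) y) x = _ := h.fderiv
  rw [h']
  simp

end Combination

theorem linearIndependent_fderiv_of_gradient {ι : Type*} {k : ℕ} {φ : ι → Eu k → ℝ} {x : Eu k}
    (h : LinearIndependent ℝ fun i => gradient (φ i) x) :
    LinearIndependent ℝ fun i => (fderiv ℝ (φ i) x : Eu k →ₗ[ℝ] ℝ) := by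
  have h1 : LinearMap.ker (innerₗ (Eu k)) = ⊥ := by
    rw [LinearMap.ker_eq_bot']
    intro y hy
    exact inner_self_eq_zero.1 (LinearMap.congr_fun hy y)
  have h2 := h.map' _ h1
  have h3 : (fun i => (fderiv ℝ (φ i) x : Eu k →ₗ[ℝ] ℝ)) =
      innerₗ (Eu k) ∘ fun i => gradient (φ i) x := by
    ext i d
    exact (inner_gradient_eq_fderiv _ _ _).symm
  rwa [h3]

/-! ### Lower-level necessary conditions -/

namespace MinimaxProblem

variable {n m m₁ m₂ n₁ n₂ : ℕ} {P : MinimaxProblem n m m₁ m₂ n₁ n₂} {xs : Eu n} {ys : Eu m}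

theorem IsLowerKKT.lam_eq_zero {μ : Eu m₁} {lam : Eu m₂} (h : P.IsLowerKKT xs ys μ lam) (i : Fin m₂)
    (hi : P.g xs ys i ≠ 0) : lam i = 0 := by
  obtain ⟨-, -, h1, h2, h3⟩ := h
  have := (Finset.sum_eq_zero_iff_of_nonpos fun i _ =>
    mul_nonpos_of_nonneg_of_nonpos (h1 i) (h2 i)).1 h3 i (Finset.mem_univ i)
  exact (mul_eq_zero.1 this).resolve_right hi

theorem linearIndependent_fderiv_lower (hlicq : P.LowerLICQ xs ys) :
    LinearIndependent ℝ fun k : Fin m₁ ⊕ P.ActiveLower xs ys =>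
      (fderiv ℝ (k.elim (fun j y => P.h xs y j) fun i y => P.g xs y i.1) ys : Eu m →ₗ[ℝ] ℝ) := by
  refine linearIndependent_fderiv_of_gradient ?_
  have h : (fun k : Fin m₁ ⊕ P.ActiveLower xs ys => gradient
      (k.elim (fun j y => P.h xs y j) fun i y => P.g xs y i.1) ys) =
      Sum.elim (P.gradYh xs ys) fun i : P.ActiveLower xs ys => P.gradYg xs ys i.1 := by
    ext (j | i) <;> rfl
  rwa [h]

/-- Complementarity annihilates inactive multipliers, so subtracting two stationarity equations
gives a relation among the active gradients alone. -/
theorem IsLowerKKT.unique {μ μ' : Eu m₁} {lam lam' : Eu m₂}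
    (hf : DifferentiableAt ℝ (P.f xs) ys) (hh : ∀ j, DifferentiableAt ℝ (fun y => P.h xs y j) ys)
    (hg : ∀ i, DifferentiableAt ℝ (fun y => P.g xs y i) ys) (hlicq : P.LowerLICQ xs ys)
    (h : P.IsLowerKKT xs ys μ lam) (h' : P.IsLowerKKT xs ys μ' lam') : μ' = μ ∧ lam' = lam := by
  classical
  have hst : ∀ {μ : Eu m₁} {lam : Eu m₂}, P.IsLowerKKT xs ys μ lam →
      fderiv ℝ (P.f xs) ys + ∑ j, μ j • fderiv ℝ (fun y => P.h xs y j) ys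
        - ∑ i, lam i • fderiv ℝ (fun y => P.g xs y i) ys = 0 := by
    intro μ lam hk
    rw [← (hasFDerivAt_lagrangian hf hh hg μ lam).fderiv]
    ext d
    have := inner_gradient_eq_fderiv (fun y => P.lagr xs y μ lam) ys d
    rw [show gradient (fun y => P.lagr xs y μ lam) ys = 0 from hk.1, inner_zero_left] at this
    exact this.symm
  have hact : ∀ (w : Fin m₂ → ℝ) (B : Fin m₂ → Eu m →L[ℝ] ℝ) (d : Eu m),
      (∀ i, P.g xs ys i ≠ 0 → w i = 0) →
      ∑ i : P.ActiveLower xs ys, w i.1 * B i.1 d = ∑ i, w i * B i d := by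
    intro w B d hw
    rw [← Finset.sum_subtype (Finset.univ.filter fun i => P.g xs ys i = 0) (by simp)
      fun i => w i * B i d]
    refine Finset.sum_subset (Finset.subset_univ _) fun i _ hi => ?_
    rw [hw i (by simpa using hi), zero_mul]
  have hcomb := Fintype.linearIndependent_iff.1 (linearIndependent_fderiv_lower hlicq)
    (Sum.elim (fun j => μ' j - μ j) fun i => -(lam' i.1 - lam i.1)) (by
      ext d
      have e1 := congrArg (fun l => l d) (hst h)
      have e2 := congrArg (fun l => l d) (hst h')
      have e3 := hact lam (fun i => fderiv ℝ (fun y => P.g xs y i) ys) d h.lam_eq_zero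
      have e4 := hact lam' (fun i => fderiv ℝ (fun y => P.g xs y i) ys) d h'.lam_eq_zero
      simp [Fintype.sum_sum_type, sub_mul, Finset.sum_sub_distrib] at e1 e2 e3 e4 ⊢
      rw [e3, e4]
      linarith)
  refine ⟨?_, ?_⟩
  · ext j
    exact sub_eq_zero.1 (hcomb (.inl j))
  · ext i
    by_cases hi : P.g xs ys i = 0
    · have := hcomb (.inr ⟨i, hi⟩)
      simp at this
      linarith
    · rw [h.lam_eq_zero i hi, h'.lam_eq_zero i hi]

/-- Necessary conditions at a local maximiser of the lower-level problem under LICQ. -/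
theorem exists_lowerKKT_of_local_max
    (hf : ContDiffAt ℝ 2 (P.f xs) ys) (hh : ∀ j, ContDiffAt ℝ 2 (fun y => P.h xs y j) ys)
    (hg : ∀ i, ContDiffAt ℝ 2 (fun y => P.g xs y i) ys) (hy : ys ∈ P.Y xs)
    (hmax : ∀ᶠ y in 𝓝 ys, y ∈ P.Y xs → P.f xs y ≤ P.f xs ys) (hlicq : P.LowerLICQ xs ys) :
    ∃ (μ : Eu m₁) (lam : Eu m₂), P.IsLowerKKT xs ys μ lam ∧
      ∀ d ∈ P.lowerCriticalCone xs ys, quad (P.hessYYL xs ys μ lam) d ≤ 0 := by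
  have hli := linearIndependent_fderiv_lower hlicq
  have h0 : ∀ j, P.h xs ys j = 0 := fun j => by rw [hy.1]; rfl
  -- LICQ yields a Mangasarian-Fromovitz direction.
  obtain ⟨e, he⟩ := surjective_pi_of_linearIndependent hli (Sum.elim (fun _ => 0) fun _ => -1)
  have hea : ∀ j, fderiv ℝ (fun y => P.h xs y j) ys e = 0 := fun j => congrFun he (.inl j)
  have heb : ∀ i, P.g xs ys i = 0 → fderiv ℝ (fun y => P.g xs y i) ys e < 0 := fun i hi => by
    have : fderiv ℝ (fun y => P.g xs y i) ys e = -1 := congrFun he (.inr ⟨i, hi⟩)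
    rw [this]; norm_num
  have main : ∀ d, (∀ j, fderiv ℝ (fun y => P.h xs y j) ys d = 0) →
      (∀ i, P.g xs ys i = 0 → fderiv ℝ (fun y => P.g xs y i) ys d ≤ 0) →
      fderiv ℝ (P.f xs) ys d = 0 →
      ∃ (μ : Eu m₁) (lam : Eu m₂), P.IsLowerKKT xs ys μ lam ∧
        quad (P.hessYYL xs ys μ lam) d ≤ 0 := by
    intro d hda hdb hdf
    obtain ⟨u, v, hv, hv0, hst, hr⟩ := exists_multiplier_second_order
      (a := fun j y => P.h xs y j) (b := fun i y => P.g xs y i) hh hg h0 hy.2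
      (hli.comp Sum.inl Sum.inl_injective) hea heb hda hdb
      (c := -(fderiv ℝ (P.f xs) ys : Eu m →ₗ[ℝ] ℝ))
      (r := -((1 / 2 : ℝ) * fderiv ℝ (fderiv ℝ (P.f xs)) ys d d)) (by
        intro w p hp hfeas
        have h1 := le_of_tendsto (tendsto_arc_taylor hf hdf hp) (b := 0) (by
          filter_upwards [hfeas, (tendsto_of_arc hp).eventually hmax] with t ht hm
          have := hm ⟨by ext j; exact ht.1 j, ht.2⟩
          exact mul_nonpos_of_nonneg_of_nonpos (by positivity) (by linarith))
        simp only [LinearMap.neg_apply, ContinuousLinearMap.coe_coe]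
        linarith)
    -- The multipliers belong to minimising `-f`, with stationarity `-∇f + ∑ u ∇h + ∑ v ∇g = 0`;
    -- comparing with `f + μᵀh - λᵀg` gives `μ = -u`, `λ = v`.
    refine ⟨WithLp.toLp 2 (-u), WithLp.toLp 2 v, ⟨?_, hy.1, hv, hy.2, ?_⟩, ?_⟩
    · refine ext_inner_right ℝ fun w => ?_
      have h1 := hasFDerivAt_lagrangian (hf.differentiableAt (by simp))
        (fun j => (hh j).differentiableAt (by simp)) (fun i => (hg i).differentiableAt (by simp))
        (-u) v
      rw [inner_zero_left]
      refine (inner_gradient_eq_fderiv _ ys w).trans ?_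
      refine (congrArg (fun l => l w) h1.fderiv).trans ?_
      have := hst w
      simp at this ⊢
      linarith
    · refine Finset.sum_eq_zero fun i _ => ?_
      by_cases hi : P.g xs ys i = 0
      · rw [hi, mul_zero]
      · change v i * _ = 0
        rw [hv0 i hi, zero_mul]
    · have e1 := quad_hess (contDiffAt_lagrangian hf hh hg (-u) v) d
      rw [fderiv_fderiv_lagrangian hf hh hg] at e1
      refine e1.trans_le ?_
      have e2 : ∀ {k : ℕ} (c : Fin k → ℝ) (q : Fin k → ℝ),
          ∑ i, c i * ((1 / 2 : ℝ) * q i) = (1 / 2 : ℝ) * ∑ i, c i * q i := by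
        intro k c q
        rw [Finset.mul_sum]
        exact Finset.sum_congr rfl fun i _ => by ring
      rw [e2, e2] at hr
      simp only [Pi.neg_apply, neg_mul, Finset.sum_neg_distrib]
      linarith
  -- The direction `0` provides a pair; uniqueness later identifies it with the pair obtained for
  -- each `d`.
  obtain ⟨μ, lam, hk, -⟩ := main 0 (by simp) (by simp) (by simp)
  refine ⟨μ, lam, hk, fun d hd => ?_⟩
  have hda : ∀ j, fderiv ℝ (fun y => P.h xs y j) ys d = 0 := fun j =>
    (inner_gradient_eq_fderiv _ _ _).symm.trans (hd.1 j)
  have hdb : ∀ i, P.g xs ys i = 0 → fderiv ℝ (fun y => P.g xs y i) ys d ≤ 0 := fun i hi =>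
    (inner_gradient_eq_fderiv _ _ _).symm.trans_le (hd.2.1 i hi)
  have hdf : 0 ≤ fderiv ℝ (P.f xs) ys d := hd.2.2.trans_eq (inner_gradient_eq_fderiv _ _ _)
  have hf1 := hf.differentiableAt (by simp)
  have hh1 := fun j => (hh j).differentiableAt (by simp)
  have hg1 := fun i => (hg i).differentiableAt (by simp)
  have hst := (inner_gradient_eq_fderiv (fun y => P.lagr xs y μ lam) ys d).symm.trans
    (by rw [show gradient (fun y => P.lagr xs y μ lam) ys = 0 from hk.1, inner_zero_left])
  have hst' := (congrArg (fun l => l d) (hasFDerivAt_lagrangian hf1 hh1 hg1 μ lam).fderiv).symm.trans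
    hst
  -- By stationarity this sum equals `Df(d)`, so a critical direction has `Df(d) = 0`, as `main`
  -- requires.
  have hle : ∑ i, lam i * fderiv ℝ (fun y => P.g xs y i) ys d ≤ 0 :=
    Finset.sum_nonpos fun i _ => by
      by_cases hi : P.g xs ys i = 0
      · exact mul_nonpos_of_nonneg_of_nonpos (hk.2.2.1 i) (hdb i hi)
      · rw [hk.lam_eq_zero i hi, zero_mul]
  simp [hda] at hst'
  obtain ⟨μ', lam', hk', hq⟩ := main d hda hdb (by linarith)
  obtain ⟨rfl, rfl⟩ := hk.unique hf1 hh1 hg1 hlicq hk'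
  exact hq

end MinimaxProblem

/-! ### The reduced second-order inequality for the minimax problem -/

namespace MinimaxProblem

variable {n m m₁ m₂ n₁ n₂ : ℕ} {P : MinimaxProblem n m m₁ m₂ n₁ n₂} {xs : Eu n} {ys : Eu m}

/-- The lower-level active constraints `(h, -g_α)` as functions on the product space. -/
def activeConstraint (P : MinimaxProblem n m m₁ m₂ n₁ n₂) (xs : Eu n) (ys : Eu m) :
    Fin m₁ ⊕ P.ActiveLower xs ys → Eu n × Eu m → ℝ :=
  Sum.elim (fun j p => P.h p.1 p.2 j) fun i p => -P.g p.1 p.2 i.1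

/-- The joint Lagrangian on the product space. -/
def jointLagr (P : MinimaxProblem n m m₁ m₂ n₁ n₂) (μ : Eu m₁) (lam : Eu m₂) :
    Eu n × Eu m → ℝ :=
  fun p => P.lagr p.1 p.2 μ lam

/-- `J_y (h, -g_α)`. -/
def activeJacY (P : MinimaxProblem n m m₁ m₂ n₁ n₂) (xs : Eu n) (ys : Eu m) :
    Matrix (Fin m₁ ⊕ P.ActiveLower xs ys) (Fin m) ℝ :=
  Matrix.fromRows (P.jacYh xs ys) (-(P.jacYgActive xs ys))

/-- `J_x (h, -g_α)`. -/
def activeJacX (P : MinimaxProblem n m m₁ m₂ n₁ n₂) (xs : Eu n) (ys : Eu m) :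
    Matrix (Fin m₁ ⊕ P.ActiveLower xs ys) (Fin n) ℝ :=
  Matrix.fromRows (P.jacXh xs ys) (-(P.jacXgActive xs ys))

theorem Kmat_eq (μ : Eu m₁) (lam : Eu m₂) :
    P.Kmat xs ys μ lam = Matrix.fromBlocks (P.hessYYL xs ys μ lam) (P.activeJacY xs ys)ᵀ
      (P.activeJacY xs ys) 0 := by
  rw [Kmat, activeJacY, Matrix.transpose_fromRows, Matrix.transpose_neg]

theorem contDiffAt_jointLagr
    (hf : ContDiffAt ℝ 2 (fun p : Eu n × Eu m => P.f p.1 p.2) (xs, ys))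
    (hh : ContDiffAt ℝ 2 (fun p : Eu n × Eu m => P.h p.1 p.2) (xs, ys))
    (hg : ContDiffAt ℝ 2 (fun p : Eu n × Eu m => P.g p.1 p.2) (xs, ys))
    (μ : Eu m₁) (lam : Eu m₂) : ContDiffAt ℝ 2 (P.jointLagr μ lam) (xs, ys) :=
  contDiffAt_lagrangian hf (contDiffAt_euclidean.1 hh) (contDiffAt_euclidean.1 hg) μ lam

section Derivatives

variable (hh : ContDiffAt ℝ 2 (fun p : Eu n × Eu m => P.h p.1 p.2) (xs, ys))
  (hg : ContDiffAt ℝ 2 (fun p : Eu n × Eu m => P.g p.1 p.2) (xs, ys))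
include hh hg

theorem differentiableAt_activeConstraint (k : Fin m₁ ⊕ P.ActiveLower xs ys) :
    DifferentiableAt ℝ (P.activeConstraint xs ys k) (xs, ys) := by
  rcases k with j | i
  · exact (contDiffAt_euclidean.1 hh j).differentiableAt (by simp)
  · exact ((contDiffAt_euclidean.1 hg i.1).differentiableAt (by simp)).neg

theorem activeJacY_mulVec (e : Eu m) (k : Fin m₁ ⊕ P.ActiveLower xs ys) :
    (P.activeJacY xs ys *ᵥ e.ofLp) k = fderiv ℝ (P.activeConstraint xs ys k) (xs, ys) (0, e) := by
  have hhj := fun j => (contDiffAt_euclidean.1 hh j).differentiableAt (by simp)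
  have hgi := fun i => (contDiffAt_euclidean.1 hg i).differentiableAt (by simp)
  rw [mulVec_eq_apply (ℓ := fun k => (fderiv ℝ (P.activeConstraint xs ys k) (xs, ys)).comp
    (ContinuousLinearMap.inr ℝ (Eu n) (Eu m))) ?_ e k]
  · simp
  rintro (j | i) l
  · rw [activeJacY, Matrix.fromRows_apply_inl, jacYh, jac_apply_eq_fderiv fun i =>
      (contDiffAt_partial_right (contDiffAt_euclidean.1 hh i)).differentiableAt (by simp),
      fderiv_partial_right (hhj j)]
    simp [activeConstraint]
  · rw [activeJacY, Matrix.fromRows_apply_inr, Matrix.neg_apply, jacYgActive,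
      Matrix.submatrix_apply, jac_apply_eq_fderiv fun i =>
      (contDiffAt_partial_right (contDiffAt_euclidean.1 hg i)).differentiableAt (by simp),
      fderiv_partial_right (hgi i.1)]
    simp [activeConstraint, fderiv_fun_neg]

theorem activeJacX_mulVec (d : Eu n) (k : Fin m₁ ⊕ P.ActiveLower xs ys) :
    (P.activeJacX xs ys *ᵥ d.ofLp) k = fderiv ℝ (P.activeConstraint xs ys k) (xs, ys) (d, 0) := by
  have hhj := fun j => (contDiffAt_euclidean.1 hh j).differentiableAt (by simp)
  have hgi := fun i => (contDiffAt_euclidean.1 hg i).differentiableAt (by simp)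
  rw [mulVec_eq_apply (ℓ := fun k => (fderiv ℝ (P.activeConstraint xs ys k) (xs, ys)).comp
    (ContinuousLinearMap.inl ℝ (Eu n) (Eu m))) ?_ d k]
  · simp
  rintro (j | i) l
  · rw [activeJacX, Matrix.fromRows_apply_inl, jacXh, jac_apply_eq_fderiv fun i =>
      (contDiffAt_partial_left (contDiffAt_euclidean.1 hh i)).differentiableAt (by simp),
      fderiv_partial_left (hhj j)]
    simp [activeConstraint]
  · rw [activeJacX, Matrix.fromRows_apply_inr, Matrix.neg_apply, jacXgActive,
      Matrix.submatrix_apply, jac_apply_eq_fderiv fun i =>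
      (contDiffAt_partial_left (contDiffAt_euclidean.1 hg i)).differentiableAt (by simp),
      fderiv_partial_left (hgi i.1)]
    simp [activeConstraint, fderiv_fun_neg]

theorem eq_zero_of_activeJacY_transpose_mulVec (hlicq : P.LowerLICQ xs ys)
    (s : Fin m₁ ⊕ P.ActiveLower xs ys → ℝ) (hs : (P.activeJacY xs ys)ᵀ *ᵥ s = 0) : s = 0 := by
  have hhj := fun j => (contDiffAt_euclidean.1 hh j).differentiableAt (by simp)
  have hgi := fun i => (contDiffAt_euclidean.1 hg i).differentiableAt (by simp)
  have h1 := Fintype.linearIndependent_iff.1 (linearIndependent_fderiv_lower hlicq)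
    (Sum.elim (fun j => s (.inl j)) fun i => -s (.inr i)) (by
      ext e
      have h2 : s ⬝ᵥ P.activeJacY xs ys *ᵥ e.ofLp = 0 := by
        rw [Matrix.dotProduct_mulVec, ← Matrix.mulVec_transpose, hs, zero_dotProduct]
      simp only [dotProduct, activeJacY_mulVec hh hg, Fintype.sum_sum_type, activeConstraint,
        Sum.elim_inl, Sum.elim_inr, fderiv_fun_neg] at h2
      simp only [Fintype.sum_sum_type, Sum.elim_inl, Sum.elim_inr, LinearMap.add_apply,
        LinearMap.sum_apply, LinearMap.smul_apply, ContinuousLinearMap.coe_coe, smul_eq_mul,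
        LinearMap.zero_apply, neg_mul, fderiv_partial_right (hhj _), fderiv_partial_right (hgi _)]
      rw [← h2]
      congr 1
      exact Finset.sum_congr rfl fun i _ => (mul_neg _ _).symm)
  ext (j | i)
  · exact h1 (.inl j)
  · simpa using h1 (.inr i)

variable {μ : Eu m₁} {lam : Eu m₂}
  (hf : ContDiffAt ℝ 2 (fun p : Eu n × Eu m => P.f p.1 p.2) (xs, ys))
include hf

theorem IsLowerKKT.fderiv_jointLagr (hk : P.IsLowerKKT xs ys μ lam) (e : Eu m) :
    fderiv ℝ (P.jointLagr μ lam) (xs, ys) (0, e) = 0 := by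
  have hL := contDiffAt_jointLagr hf hh hg μ lam
  rw [← fderiv_partial_right (hL.differentiableAt (by simp)), ← inner_gradient_eq_fderiv]
  have : gradient (fun y => P.jointLagr μ lam (xs, y)) ys = 0 := hk.1
  rw [this, inner_zero_left]

/-- When all active linearisations vanish at `e`, stationarity and complementarity force `∇_y f · e
= 0`. This transfers the second-order condition to the kernel on which `isUnit_det_saddle` needs it.
-/
theorem mem_lowerCriticalCone_of_activeJacY (hk : P.IsLowerKKT xs ys μ lam) {e : Eu m}
    (he : P.activeJacY xs ys *ᵥ e.ofLp = 0) : e ∈ P.lowerCriticalCone xs ys := by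
  have hh' := contDiffAt_euclidean.1 hh
  have hg' := contDiffAt_euclidean.1 hg
  have hhj := fun j => (hh' j).differentiableAt (by simp)
  have hgi := fun i => (hg' i).differentiableAt (by simp)
  have h1 : ∀ j, fderiv ℝ (fun p : Eu n × Eu m => P.h p.1 p.2 j) (xs, ys) (0, e) = 0 := fun j => by
    have := activeJacY_mulVec hh hg e (.inl j)
    rw [he] at this
    exact this.symm
  have h2 : ∀ i, P.g xs ys i = 0 →
      fderiv ℝ (fun p : Eu n × Eu m => P.g p.1 p.2 i) (xs, ys) (0, e) = 0 := fun i hi => by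
    have := activeJacY_mulVec hh hg e (.inr ⟨i, hi⟩)
    rw [he] at this
    simpa [activeConstraint, fderiv_fun_neg] using this
  refine ⟨fun j => ?_, fun i hi => ?_, ?_⟩
  · rw [gradYh, inner_gradient_eq_fderiv, fderiv_partial_right (hhj j), h1]
  · rw [gradYg, inner_gradient_eq_fderiv, fderiv_partial_right (hgi i), h2 i hi]
  · have hfd := hf.differentiableAt (by simp)
    rw [gradYf, inner_gradient_eq_fderiv]
    rw [fderiv_partial_right (F := fun p : Eu n × Eu m => P.f p.1 p.2) hfd]
    have h3 := hk.fderiv_jointLagr hh hg hf e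
    have h4 : fderiv ℝ (P.jointLagr μ lam) (xs, ys) = _ :=
      (hasFDerivAt_lagrangian hfd hhj hgi μ lam).fderiv
    have h5 : ∑ i, lam i * fderiv ℝ (fun p : Eu n × Eu m => P.g p.1 p.2 i) (xs, ys) (0, e) = 0 :=
      Finset.sum_eq_zero fun i _ => by
        by_cases hi : P.g xs ys i = 0
        · rw [h2 i hi, mul_zero]
        · rw [hk.lam_eq_zero i hi, zero_mul]
    rw [h4] at h3
    simp [h1, h5] at h3
    rw [h3]

theorem LowerJacobianUniqueness.neg_def (hJ : P.LowerJacobianUniqueness xs ys μ lam)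
    (y : Fin m → ℝ) (hy : P.activeJacY xs ys *ᵥ y = 0) (hy0 : y ≠ 0) :
    y ⬝ᵥ P.hessYYL xs ys μ lam *ᵥ y < 0 := by
  have := hJ.second_order (WithLp.toLp 2 y)
    (mem_lowerCriticalCone_of_activeJacY hh hg hf hJ.kkt hy) (by simpa using hy0)
  rwa [quad_eq_dotProduct] at this

theorem LowerJacobianUniqueness.isUnit_det_Kmat (hJ : P.LowerJacobianUniqueness xs ys μ lam) :
    IsUnit (P.Kmat xs ys μ lam).det := by
  rw [Kmat_eq]
  exact isUnit_det_saddle (hJ.neg_def hh hg hf)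
    (eq_zero_of_activeJacY_transpose_mulVec hh hg hJ.licq)

theorem hessXYL_apply (i : Fin m) (j : Fin n) :
    P.hessXYL xs ys μ lam i j = fderiv ℝ (fderiv ℝ (P.jointLagr μ lam)) (xs, ys)
      (EuclideanSpace.single j 1, 0) (0, EuclideanSpace.single i 1) := by
  have hL := contDiffAt_jointLagr hf hh hg μ lam
  have h1 : ∀ i : Fin m, HasFDerivAt (fun x' => P.gradYL x' ys μ lam i) _ xs := fun i => by
    simp only [gradYL, gradient_apply_eq_fderiv]
    exact hasFDerivAt_fderiv_partial_right hL (EuclideanSpace.single i 1)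
  rw [hessXYL, jac_apply_eq_fderiv fun i => (h1 i).differentiableAt, (h1 i).fderiv]
  simp

/-- The joint second derivative at `(d, e)` splits into the `xx`, mixed and `yy` blocks, the form
bounded by `quadratic_le_schur`. -/
theorem LowerJacobianUniqueness.second_deriv_le_reducedHess
    (hJ : P.LowerJacobianUniqueness xs ys μ lam) {d : Eu n} {e : Eu m}
    (hde : ∀ k, fderiv ℝ (P.activeConstraint xs ys k) (xs, ys) (d, e) = 0) :
    fderiv ℝ (fderiv ℝ (P.jointLagr μ lam)) (xs, ys) (d, e) (d, e) ≤
      quad (P.reducedHess xs ys μ lam) d := by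
  have hL := contDiffAt_jointLagr hf hh hg μ lam
  have hLy : ContDiffAt ℝ 2 (fun y => P.lagr xs y μ lam) ys := contDiffAt_partial_right hL
  have hsplit : ((d, e) : Eu n × Eu m) = (d, 0) + (0, e) := by simp
  have hsymm : IsSymmSndFDerivAt ℝ (P.jointLagr μ lam) (xs, ys) := hL.isSymmSndFDerivAt (by simp)
  have hde' : P.activeJacX xs ys *ᵥ d.ofLp + P.activeJacY xs ys *ᵥ e.ofLp = 0 := by
    ext k
    rw [Pi.add_apply, activeJacX_mulVec hh hg, activeJacY_mulVec hh hg, ← map_add, ← hsplit]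
    exact hde k
  have h := quadratic_le_schur (R := P.hessXXL xs ys μ lam) (T := P.hessXYL xs ys μ lam)
    (S := P.hessYYL xs ys μ lam) (hess_transpose hLy) (hJ.neg_def hh hg hf)
    (eq_zero_of_activeJacY_transpose_mulVec hh hg hJ.licq) hde'
  have hR : d.ofLp ⬝ᵥ P.hessXXL xs ys μ lam *ᵥ d.ofLp =
      fderiv ℝ (fderiv ℝ (P.jointLagr μ lam)) (xs, ys) (d, 0) (d, 0) := by
    rw [← fderiv_fderiv_partial_left hL, ← quad_hess (contDiffAt_partial_left hL),
      quad_eq_dotProduct]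
    rfl
  have hS : e.ofLp ⬝ᵥ P.hessYYL xs ys μ lam *ᵥ e.ofLp =
      fderiv ℝ (fderiv ℝ (P.jointLagr μ lam)) (xs, ys) (0, e) (0, e) := by
    rw [← fderiv_fderiv_partial_right hL, ← quad_hess (contDiffAt_partial_right hL),
      quad_eq_dotProduct]
    rfl
  have hT : e.ofLp ⬝ᵥ P.hessXYL xs ys μ lam *ᵥ d.ofLp =
      fderiv ℝ (fderiv ℝ (P.jointLagr μ lam)) (xs, ys) (d, 0) (0, e) := by
    rw [dotProduct_mulVec_eq_apply (D := (((fderiv ℝ (fderiv ℝ (P.jointLagr μ lam)) (xs, ys)).comp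
      (ContinuousLinearMap.inl ℝ (Eu n) (Eu m))).flip.comp
        (ContinuousLinearMap.inr ℝ (Eu n) (Eu m))).flip)
      (fun i j => by rw [hessXYL_apply hh hg hf]; simp)]
    simp
  rw [quad_eq_dotProduct, reducedHess, Kmat_eq, Nmat]
  refine le_trans (le_of_eq ?_) h
  rw [hR, hS, hT, hsplit, map_add, map_add, _root_.add_apply,
    _root_.add_apply,
    show fderiv ℝ (fderiv ℝ (P.jointLagr μ lam)) (xs, ys) (0, e) (d, 0) = _ from hsymm.eq _ _]
  ring

/-- The second-order inequality for the reduced problem along a feasible second-order arc. -/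
theorem IsLocalMinimax.reduced_nonneg_of_arc (hmm : P.IsLocalMinimax xs ys)
    (hJ : P.LowerJacobianUniqueness xs ys μ lam) {d w : Eu n}
    (hd : fderiv ℝ (fun x' => P.lagr x' ys μ lam) xs d = 0) {p : ℝ → Eu n}
    (hp : Tendsto (fun t : ℝ => (t ^ 2)⁻¹ • (p t - xs - t • d)) (𝓝[>] 0) (𝓝 w))
    (hfeas : ∀ᶠ t in 𝓝[>] 0, p t ∈ P.Phi) :
    0 ≤ fderiv ℝ (fun x' => P.lagr x' ys μ lam) xs w +
      (1 / 2 : ℝ) * quad (P.reducedHess xs ys μ lam) d := by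
  obtain ⟨-, hys, δ₀, η, hδ₀, -, hη, hmax⟩ := hmm
  have hL := contDiffAt_jointLagr hf hh hg μ lam
  have hLd := hL.differentiableAt (by simp)
  have hDx : ∀ v, fderiv ℝ (fun x' => P.lagr x' ys μ lam) xs v =
      fderiv ℝ (P.jointLagr μ lam) (xs, ys) (v, 0) := fun v => fderiv_partial_left hLd v
  -- The added `t` keeps the radius positive even when `p t = xs`.
  let δ : ℝ → ℝ := fun t => dist (p t) xs + t
  have hδ : Tendsto δ (𝓝[>] 0) (𝓝 0) := by
    have h0 : Tendsto (fun t : ℝ => t) (𝓝[>] 0) (𝓝 0) := nhdsWithin_le_nhds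
    simpa using (tendsto_iff_dist_tendsto_zero.1 (tendsto_of_arc hp)).add h0
  have hδpos : ∀ᶠ t in 𝓝[>] 0, 0 < δ t := by
    filter_upwards [self_mem_nhdsWithin] with t ht
    have ht : 0 < t := ht
    have := dist_nonneg (x := p t) (y := xs)
    simp only [δ]; linarith
  have hηδ : Tendsto (fun t => η (δ t)) (𝓝[>] 0) (𝓝 0) :=
    hη.comp (tendsto_nhdsWithin_iff.2 ⟨hδ, hδpos⟩)
  have hz : ∀ᶠ t in 𝓝[>] 0, ∃ z, z ∈ P.Y (p t) ∧ dist z ys ≤ η (δ t) ∧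
      P.f xs ys ≤ P.f (p t) z := by
    filter_upwards [hfeas, hδpos, hδ.eventually_le_const hδ₀, self_mem_nhdsWithin]
      with t hpt hpos hle ht
    have ht : 0 < t := ht
    obtain ⟨-, M, ⟨⟨z, ⟨hzY, hzb⟩, rfl⟩, -⟩, hM⟩ := hmax (δ t) ⟨hpos, hle⟩ (p t)
      ⟨by simp only [Metric.mem_closedBall, δ]; linarith, hpt⟩ ys
      ⟨hys, Metric.mem_closedBall_self hpos.le⟩
    exact ⟨z, hzY, hzb, hM⟩
  have hsk : ∀ t, ∃ z, (∃ z, z ∈ P.Y (p t) ∧ dist z ys ≤ η (δ t) ∧ P.f xs ys ≤ P.f (p t) z) →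
      z ∈ P.Y (p t) ∧ dist z ys ≤ η (δ t) ∧ P.f xs ys ≤ P.f (p t) z := fun t => by
    by_cases h : ∃ z, z ∈ P.Y (p t) ∧ dist z ys ≤ η (δ t) ∧ P.f xs ys ≤ P.f (p t) z
    · exact h.imp fun z hz _ => hz
    · exact ⟨0, fun h' => absurd h' h⟩
  choose q hq using hsk
  have hq' := hz.mono fun t ht => hq t ht
  have hqlim : Tendsto q (𝓝[>] 0) (𝓝 ys) :=
    tendsto_iff_dist_tendsto_zero.2 (squeeze_zero' (.of_forall fun _ => dist_nonneg)
      (hq'.mono fun t ht => ht.2.1) hηδ)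
  have hterm : ∀ t, q t ∈ P.Y (p t) → ∀ i, 0 ≤ -(lam i * P.g (p t) (q t) i) := fun t ht i => by
    have := mul_nonneg (hJ.kkt.2.2.1 i) (neg_nonneg.2 (ht.2 i))
    linarith
  -- Every summand on the right is nonnegative for these responses, so the Lagrangian gain dominates
  -- each `-λ_i g_i`.
  have hdiff : ∀ t, q t ∈ P.Y (p t) → P.jointLagr μ lam (p t, q t) - P.jointLagr μ lam (xs, ys) =
      P.f (p t) (q t) - P.f xs ys + ∑ i, -(lam i * P.g (p t) (q t) i) := fun t ht => by
    have h1 := hJ.kkt.2.2.2.2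
    simp only [jointLagr, lagr, ht.1, hJ.kkt.2.1, h1, Finset.sum_neg_distrib]
    simp
    ring
  obtain ⟨e, he, hpos⟩ := exists_direction_of_arc_response (k := P.activeConstraint xs ys) hL
    (differentiableAt_activeConstraint hh hg)
    (by
      rintro (j | i)
      · simp [activeConstraint, hys.1]
      · simpa [activeConstraint] using i.2)
    (hJ.kkt.fderiv_jointLagr hh hg hf) ((hDx d).symm.trans hd)
    (by
      intro e he0 he
      have h1 := hJ.neg_def hh hg hf e.ofLp (by
        ext k; rw [activeJacY_mulVec hh hg, he]; rfl) (by simpa using he0)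
      rw [← quad_eq_dotProduct] at h1
      rw [← fderiv_fderiv_partial_right hL, ← quad_hess (contDiffAt_partial_right hL)]
      exact h1)
    hp hqlim
    (by
      filter_upwards [hq'] with t ht
      have h1 := hdiff t ht.1
      have h2 := Finset.sum_nonneg fun i (_ : i ∈ Finset.univ) => hterm t ht.1 i
      linarith [ht.2.2])
    -- The equality constraints vanish along the responses, so any positive weight works; for active
    -- inequalities strict complementarity makes `lam i` positive.
    (σ := Sum.elim (fun _ => 1) fun i => lam i.1)
    (by
      rintro (j | i)
      · simp
      · have := hJ.strict_compl i.1
        rw [i.2, sub_zero] at this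
        exact this)
    (by
      intro k
      filter_upwards [hq'] with t ht
      have h1 := hdiff t ht.1
      have h2 := Finset.sum_nonneg fun i (_ : i ∈ Finset.univ) => hterm t ht.1 i
      rcases k with j | i
      · simp only [activeConstraint, Sum.elim_inl, ht.1.1]
        simp
        linarith [ht.2.2]
      · simp only [activeConstraint, Sum.elim_inr, abs_neg, abs_of_nonpos (ht.1.2 i.1)]
        have h3 := Finset.single_le_sum (fun i (_ : i ∈ Finset.univ) => hterm t ht.1 i)
          (Finset.mem_univ i.1)
        linarith [ht.2.2])
  have := hJ.second_deriv_le_reducedHess hh hg hf he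
  rw [hDx]
  linarith

end Derivatives

/-! ### Upper-level multipliers -/

section Upper

variable {μ : Eu m₁} {lam : Eu m₂}

theorem convex_upperMultipliers : Convex ℝ (P.upperMultipliers xs ys μ lam) := by
  rintro ⟨u, v⟩ ⟨h1, h2, h3, h4, h5⟩ ⟨u', v'⟩ ⟨h1', -, h3', -, h5'⟩ a b ha hb hab
  refine ⟨?_, h2, fun i => ?_, h4, ?_⟩
  · have h6 := congrArg₂ (fun s t => a • s + b • t) h1 h1'
    have h7 : P.gradXL xs ys μ lam = (a + b) • P.gradXL xs ys μ lam := by rw [hab, one_smul]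
    simp only [smul_zero, add_zero] at h6
    rw [← h6, h7]
    simp only [hab, one_smul]
    conv_lhs => rw [h7]
    simp only [Prod.smul_mk, Prod.mk_add_mk, PiLp.add_apply, PiLp.smul_apply, smul_eq_mul,
      add_smul, Finset.sum_add_distrib, Finset.smul_sum, mul_smul, smul_add]
    abel
  · have h6 := mul_nonneg ha (h3 i)
    have h7 := mul_nonneg hb (h3' i)
    simpa using add_nonneg h6 h7
  · have := congrArg₂ (fun s t => a * s + b * t) h5 h5'
    simp only [mul_zero, add_zero] at this
    rw [← this]
    simp [add_mul, Finset.sum_add_distrib, Finset.mul_sum, mul_assoc]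

theorem isClosed_upperMultipliers : IsClosed (P.upperMultipliers xs ys μ lam) := by
  have h1 : IsClosed {w : Eu n₁ × Eu n₂ | P.gradXL xs ys μ lam + ∑ j, w.1 j • P.gradH xs j +
      ∑ i, w.2 i • P.gradG xs i = 0} := isClosed_eq (by fun_prop) continuous_const
  have h2 : IsClosed {w : Eu n₁ × Eu n₂ | ∀ i, 0 ≤ w.2 i} := by
    rw [Set.ofPred_forall]
    exact isClosed_iInter fun i => isClosed_le continuous_const (by fun_prop)
  have h3 : IsClosed {w : Eu n₁ × Eu n₂ | ∑ i, w.2 i * P.G xs i = 0} :=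
    isClosed_eq (by fun_prop) continuous_const
  exact h1.inter ((isClosed_const (p := P.H xs = 0)).inter
    (h2.inter ((isClosed_const (p := ∀ i, P.G xs i ≤ 0)).inter h3)))

theorem upperMultipliers_snd_eq_zero {w : Eu n₁ × Eu n₂} (hw : w ∈ P.upperMultipliers xs ys μ lam)
    (i : Fin n₂) (hi : P.G xs i ≠ 0) : w.2 i = 0 := by
  obtain ⟨-, -, h1, h2, h3⟩ := hw
  have := (Finset.sum_eq_zero_iff_of_nonpos fun i _ =>
    mul_nonpos_of_nonneg_of_nonpos (h1 i) (h2 i)).1 h3 i (Finset.mem_univ i)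
  exact (mul_eq_zero.1 this).resolve_right hi

/-- MFCQ bounds each coordinate of a multiplier, placing this closed set in a product of two compact
boxes. -/
theorem isCompact_upperMultipliers (hM : P.UpperMFCQ xs) :
    IsCompact (P.upperMultipliers xs ys μ lam) := by
  obtain ⟨hli, e, heH, heG⟩ := hM
  obtain ⟨R, hR⟩ := isBounded_multipliers hli (s := {i | P.G xs i = 0}) heH heG
    (P.gradXL xs ys μ lam)
  have hbox : ∀ k : ℕ, IsCompact {y : Eu k | ∀ i, |y i| ≤ R} := fun k => by
    have h1 : IsCompact (Set.univ.pi fun _ : Fin k => Set.Icc (-R) R) :=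
      isCompact_univ_pi fun _ => isCompact_Icc
    have h2 := h1.image (PiLp.continuous_toLp 2 fun _ : Fin k => ℝ)
    refine h2.of_isClosed_subset ?_ fun y hy => ⟨y.ofLp, fun i _ => abs_le.1 (hy i), rfl⟩
    rw [Set.ofPred_forall]
    exact isClosed_iInter fun i => isClosed_le (by fun_prop) continuous_const
  refine ((hbox n₁).prod (hbox n₂)).of_isClosed_subset isClosed_upperMultipliers fun w hw => ?_
  exact hR w.1 w.2 hw.2.2.1 (upperMultipliers_snd_eq_zero hw) hw.1

theorem quad_constraintHess (u : Eu n₁) (v : Eu n₂) (d : Eu n) :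
    quad (P.constraintHess xs u v) d = ∑ j, u j * quad (hess (fun x' => P.H x' j) xs) d +
      ∑ i, v i * quad (hess (fun x' => P.G x' i) xs) d := by
  simp only [quad_eq_dotProduct, constraintHess, Matrix.add_mulVec, Matrix.sum_mulVec,
    Matrix.smul_mulVec, dotProduct_add, dotProduct_sum, dotProduct_smul, smul_eq_mul]

/-- Upper-level multipliers satisfying the second-order inequality in a fixed direction. -/
theorem exists_upperMultiplier_of_arc (hH : ContDiffAt ℝ 2 P.H xs) (hG : ContDiffAt ℝ 2 P.G xs)
    (hxs : xs ∈ P.Phi) (hM : P.UpperMFCQ xs) {d : Eu n}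
    (hdH : ∀ j, inner ℝ (P.gradH xs j) d = 0)
    (hdG : ∀ i, P.G xs i = 0 → inner ℝ (P.gradG xs i) d ≤ 0) {r : ℝ}
    (harc : ∀ (w : Eu n) (p : ℝ → Eu n),
      Tendsto (fun t : ℝ => (t ^ 2)⁻¹ • (p t - xs - t • d)) (𝓝[>] 0) (𝓝 w) →
      (∀ᶠ t in 𝓝[>] 0, p t ∈ P.Phi) →
      0 ≤ fderiv ℝ (fun x' => P.lagr x' ys μ lam) xs w + (1 / 2 : ℝ) * r) :
    ∃ w ∈ P.upperMultipliers xs ys μ lam, 0 ≤ quad (P.constraintHess xs w.1 w.2) d + r := by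
  obtain ⟨hli, e, heH, heG⟩ := hM
  have hH' := contDiffAt_euclidean.1 hH
  have hG' := contDiffAt_euclidean.1 hG
  simp only [gradH, gradG, inner_gradient_eq_fderiv] at hdH hdG heH heG
  obtain ⟨u, v, hv, hv0, hst, hr⟩ := exists_multiplier_second_order
    (a := fun j x => P.H x j) (b := fun i x => P.G x i) hH' hG'
    (fun j => by rw [hxs.1]; rfl) hxs.2 (linearIndependent_fderiv_of_gradient hli) heH heG hdH hdG
    (c := (fderiv ℝ (fun x' => P.lagr x' ys μ lam) xs : Eu n →ₗ[ℝ] ℝ)) (r := (1 / 2 : ℝ) * r)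
    (fun w p hp hfeas => harc w p hp (by
      filter_upwards [hfeas] with t ht
      exact ⟨by ext j; exact ht.1 j, ht.2⟩))
  refine ⟨(WithLp.toLp 2 u, WithLp.toLp 2 v), ⟨?_, hxs.1, hv, hxs.2, ?_⟩, ?_⟩
  · refine ext_inner_right ℝ fun w => ?_
    have := hst w
    simp only [inner_add_left, sum_inner, inner_smul_left, gradXL, gradH, gradG,
      inner_gradient_eq_fderiv, inner_zero_left]
    simpa using this
  · refine Finset.sum_eq_zero fun i _ => ?_
    by_cases hi : P.G xs i = 0
    · rw [hi, mul_zero]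
    · change v i * _ = 0
      rw [hv0 i hi, zero_mul]
  · rw [quad_constraintHess]
    simp only [quad_hess (hH' _), quad_hess (hG' _)]
    simp only [mul_left_comm _ (1 / 2 : ℝ), ← Finset.mul_sum] at hr
    linarith

end Upper

end MinimaxProblem

/-! ### The necessary optimality conditions -/

theorem mainTheorem3 {n m m₁ m₂ n₁ n₂ : ℕ} (P : MinimaxProblem n m m₁ m₂ n₁ n₂)
    (xs : Eu n) (ys : Eu m)
    (hf : ContDiffAt ℝ 2 (fun p : Eu n × Eu m => P.f p.1 p.2) (xs, ys))
    (hh : ContDiffAt ℝ 2 (fun p : Eu n × Eu m => P.h p.1 p.2) (xs, ys))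
    (hg : ContDiffAt ℝ 2 (fun p : Eu n × Eu m => P.g p.1 p.2) (xs, ys))
    (hH : ContDiffAt ℝ 2 P.H xs)
    (hG : ContDiffAt ℝ 2 P.G xs)
    (hmm : P.IsLocalMinimax xs ys)
    (hlicq : P.LowerLICQ xs ys) :
    ∃ (μ : Eu m₁) (lam : Eu m₂),
      P.IsLowerKKT xs ys μ lam ∧
      (∀ (μ' : Eu m₁) (lam' : Eu m₂), P.IsLowerKKT xs ys μ' lam' → μ' = μ ∧ lam' = lam) ∧
      (∀ d ∈ P.lowerCriticalCone xs ys, quad (P.hessYYL xs ys μ lam) d ≤ 0) ∧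
      (P.LowerJacobianUniqueness xs ys μ lam → P.UpperMFCQ xs →
        (P.upperMultipliers xs ys μ lam).Nonempty ∧
        IsCompact (P.upperMultipliers xs ys μ lam) ∧
        Convex ℝ (P.upperMultipliers xs ys μ lam) ∧
        IsUnit (P.Kmat xs ys μ lam).det ∧
        ∀ d ∈ P.upperCriticalCone xs ys μ lam,
          ∃ M : ℝ,
            IsGreatest ((fun w : Eu n₁ × Eu n₂ => quad (P.constraintHess xs w.1 w.2) d) ''
              P.upperMultipliers xs ys μ lam) M ∧
            0 ≤ M + quad (P.reducedHess xs ys μ lam) d) := by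
  have hfy : ContDiffAt ℝ 2 (P.f xs) ys :=
    contDiffAt_partial_right (F := fun p : Eu n × Eu m => P.f p.1 p.2) hf
  have hhy := fun j => contDiffAt_partial_right (contDiffAt_euclidean.1 hh j)
  have hgy := fun i => contDiffAt_partial_right (contDiffAt_euclidean.1 hg i)
  have hmax : ∀ᶠ y in 𝓝 ys, y ∈ P.Y xs → P.f xs y ≤ P.f xs ys := by
    obtain ⟨hxs, -, δ₀, η, hδ₀, -, -, h⟩ := hmm
    filter_upwards [Metric.closedBall_mem_nhds ys hδ₀] with y hy hyY
    exact (h δ₀ ⟨hδ₀, le_rfl⟩ xs ⟨Metric.mem_closedBall_self hδ₀.le, hxs⟩ y ⟨hyY, hy⟩).1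
  obtain ⟨μ, lam, hk, h2nd⟩ :=
    MinimaxProblem.exists_lowerKKT_of_local_max hfy hhy hgy hmm.2.1 hmax hlicq
  refine ⟨μ, lam, hk, fun μ' lam' hk' => ?_, h2nd, fun hJ hM => ?_⟩
  · exact hk.unique (hfy.differentiableAt (by simp)) (fun j => (hhy j).differentiableAt (by simp))
      (fun i => (hgy i).differentiableAt (by simp)) hlicq hk'
  have hex : ∀ d, (∀ j, inner ℝ (P.gradH xs j) d = 0) →
      (∀ i, P.G xs i = 0 → inner ℝ (P.gradG xs i) d ≤ 0) →
      inner ℝ (P.gradXL xs ys μ lam) d = 0 → ∃ w ∈ P.upperMultipliers xs ys μ lam,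
        0 ≤ quad (P.constraintHess xs w.1 w.2) d + quad (P.reducedHess xs ys μ lam) d :=
    fun d hdH hdG hdL => MinimaxProblem.exists_upperMultiplier_of_arc hH hG hmm.1 hM hdH hdG
      fun w p hp hfeas => hmm.reduced_nonneg_of_arc hh hg hf hJ
        ((inner_gradient_eq_fderiv _ _ _).symm.trans hdL) hp hfeas
  -- The zero direction already gives a multiplier, so nonemptiness is available before critical
  -- directions are treated.
  obtain ⟨w₀, hw₀, -⟩ := hex 0 (by simp) (by simp) (by simp)
  have hcpt : IsCompact (P.upperMultipliers xs ys μ lam) :=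
    MinimaxProblem.isCompact_upperMultipliers hM
  refine ⟨⟨w₀, hw₀⟩, hcpt, MinimaxProblem.convex_upperMultipliers,
    hJ.isUnit_det_Kmat hh hg hf, fun d hd => ?_⟩
  -- Pairing the stationarity of `w₀` with a critical `d` gives `⟨∇_x L, d⟩ = -∑ v_i ⟨∇G_i, d⟩ ≥ 0`,
  -- so the inequality in the cone is an equality.
  have hdL : inner ℝ (P.gradXL xs ys μ lam) d = 0 := by
    refine le_antisymm hd.2.2 ?_
    have h1 := congrArg (fun y => inner ℝ y d) hw₀.1
    simp only [inner_add_left, sum_inner, inner_smul_left, inner_zero_left, hd.1, mul_zero,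
      Finset.sum_const_zero, add_zero] at h1
    have h2 : ∑ i, w₀.2 i * inner ℝ (P.gradG xs i) d ≤ 0 := Finset.sum_nonpos fun i _ => by
      by_cases hi : P.G xs i = 0
      · exact mul_nonpos_of_nonneg_of_nonpos (hw₀.2.2.1 i) (hd.2.1 i hi)
      · rw [MinimaxProblem.upperMultipliers_snd_eq_zero hw₀ i hi, zero_mul]
    simp only [conj_trivial] at h1
    linarith
  have hcont : Continuous fun w : Eu n₁ × Eu n₂ => quad (P.constraintHess xs w.1 w.2) d := by
    simp only [MinimaxProblem.quad_constraintHess]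
    fun_prop
  obtain ⟨M, hMg⟩ := (hcpt.image hcont).exists_isGreatest (Set.Nonempty.image _ ⟨w₀, hw₀⟩)
  obtain ⟨w, hw, hwd⟩ := hex d hd.1 hd.2.1 hdL
  refine ⟨M, hMg, hwd.trans (add_le_add_left (hMg.2 ⟨w, hw, rfl⟩) _)⟩

end
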